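/- **Definitions.** A *convex combination (CC) space* is a metric space $(\mathfrak X,d)$ with an operation that assigns to all $u_1,\dots,u_n\in\mathfrak X$ and all $\lambda_1,\dots,\lambda_n>0$ with $\sum_i\lambda_i=1$ a point $[\lambda_i,u_i]_{i=1}^n=[\lambda_1,u_1;\dots;\lambda_n,u_n]\in\mathfrak X$ such that $[1,u]=u$ and 1. $[\lambda_i,u_i]_{i=1}^n=[\lambda_{\sigma(i)},u_{\sigma(i)}]_{i=1}^n$ for every permutation $\sigma$; 2. $[\lambda_i,u_i]_{i=1}^{n+2}=\bigl[\lambda_1,u_1;\dots;\lambda_n,u_n;\lambda_{n+1}+\lambda_{n+2},\bigl[\tfrac{\lambda_{n+j}}{\lambda_{n+1}+\lambda_{n+2}},u_{n+j}\bigr]_{j=1}^2\bigr]$; 3. if $\lambda^{(k)}\to\lambda$ with $\lambda^{(k)},\lambda\in(0,1)$, then $[\lambda^{(k)},u;1-\lambda^{(k)},v]\to[\lambda,u;1-\lambda,v]$; 4. $d([\lambda,u_1;1-\lambda,u_2],[\lambda,v_1;1-\lambda,v_2])\le\lambda d(u_1,v_1)+(1-\lambda)d(u_2,v_2)$ for $\lambda\in(0,1)$;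 5. for each $u$ the limit $Ku:=\lim_{n\to\infty}[n^{-1},u]_{i=1}^n$ exists. For points of $K(\mathfrak X)$, zero weights are allowed, and the corresponding terms are dropped. Let $(\Omega,\mathcal F,P)$ be a probability space and let $\mathfrak X$ be a complete separable CC space with its Borel $\sigma$-algebra. For a sub-$\sigma$-algebra $\mathcal G\subset\mathcal F$ and $p\ge1$, $L^p_{\mathfrak X}(\mathcal G)$ is the set of $\mathcal G$-measurable $X:\Omega\to\mathfrak X$ with $E\,d(a,X)^p<\infty$ for some $a\in\mathfrak X$, $L^p_{\mathfrak X}:=L^p_{\mathfrak X}(\mathcal F)$, and $\Delta_p(X,Y):=(E\,d(X,Y)^p)^{1/p}$. A simple random element $S$ with the distinct values $x_1,\dots,x_n$ has the conditional expectation $E(S|\mathcal G):=[E(I_{\{S=x_i\}}|\mathcal G),Kx_i]_{i=1}^n$. Fix $u_0\in K(\mathfrak X)$ and a sequence $(u_j)_{j\ge1}$ dense in $\mathfrak X$, and let $\psi_n(x)$ be the nearest point to $x$ among $u_0,\dots,u_n$ (the one of smallest index in case of ties). For $X\in L^1_{\mathfrak X}$, $E(X|\mathcal G)$ is the $\mathcal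 G$-measurable map, unique up to null sets, with $E(X|\mathcal G)=\lim_{n\to\infty}E(\psi_n(X)|\mathcal G)$ a.s. **Proposition 4.13 (martingale convergence).** Let $p\ge1$ and $X\in L^p_{\mathfrak X}$. Then $E(X|\mathcal G)$ exists for every sub-$\sigma$-algebra $\mathcal G\subset\mathcal F$, and the following hold. (i) Let $(\mathcal F_n)_{n\ge1}$ be an increasing sequence of sub-$\sigma$-algebras of $\mathcal F$ and $\mathcal F_\infty=\sigma(\bigcup_{n\ge1}\mathcal F_n)$. Then $E(X|\mathcal F_n)\to E(X|\mathcal F_\infty)$ a.s. and in $L^p_{\mathfrak X}$ as $n\to\infty$; that is, $E(X|\mathcal F_n)\in L^p_{\mathfrak X}(\mathcal F_n)$ for all $n$, $E(X|\mathcal F_\infty)\in L^p_{\mathfrak X}(\mathcal F_\infty)$ and $\Delta_p(E(X|\mathcal F_n),E(X|\mathcal F_\infty))\to0$. (ii) Let $(\mathcal F_{-n})_{n\ge1}$ be a decreasing sequence of sub-$\sigma$-algebras of $\mathcal F$ and $\mathcal F_{-\infty}=\bigcap_{n\ge1}\mathcal F_{-n}$. Then $E(X|\mathcal F_{-n})\to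 E(X|\mathcal F_{-\infty})$ a.s. and in $L^p_{\mathfrak X}$ as $n\to\infty$, in the same sense. -/

import Mathlib

open MeasureTheory Filter Topology

noncomputable section

/-- Positive weights `λ₁, …, λₙ > 0` with `λ₁ + ⋯ + λₙ = 1`. -/
def IsWeight {n : ℕ} (w : Fin n → ℝ) : Prop :=
  (∀ i, 0 < w i) ∧ ∑ i, w i = 1

/-- A convex combination space: a metric space with a convex combination operation
`comb w u = [w₁, u₁; …; wₙ, uₙ]`. The operation is meaningful, and constrained, only for
positive weights that sum to one. -/
class CCSpace (E : Type*) [MetricSpace E] where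
  /-- the operation `[w₁, u₁; …; wₙ, uₙ]` -/
  comb : {n : ℕ} → (Fin n → ℝ) → (Fin n → E) → E
  /-- `[1, u] = u` -/
  comb_one : ∀ u : E, comb ![1] ![u] = u
  /-- commutativity -/
  comb_perm : ∀ {n : ℕ} (w : Fin n → ℝ) (u : Fin n → E) (σ : Equiv.Perm (Fin n)),
    IsWeight w → comb (fun i => w (σ i)) (fun i => u (σ i)) = comb w u
  /-- associativity; `wₙ₊₁` is `w (Fin.last n).castSucc` and `wₙ₊₂` is `w (Fin.last (n + 1))` -/
  comb_assoc : ∀ {n : ℕ} (w : Fin (n + 2) → ℝ) (u : Fin (n + 2) → E), IsWeight w →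
    comb w u =
      comb
        (Fin.snoc (α := fun _ => ℝ) (fun i : Fin n => w i.castSucc.castSucc)
          (w (Fin.last n).castSucc + w (Fin.last (n + 1))))
        (Fin.snoc (α := fun _ => E) (fun i : Fin n => u i.castSucc.castSucc)
          (comb
            ![w (Fin.last n).castSucc / (w (Fin.last n).castSucc + w (Fin.last (n + 1))),
              w (Fin.last (n + 1)) / (w (Fin.last n).castSucc + w (Fin.last (n + 1)))]
            ![u (Fin.last n).castSucc, u (Fin.last (n + 1))]))
  /-- continuity in the weight -/
  comb_tendsto : ∀ (u v : E) (l : ℕ → ℝ) (t : ℝ), (∀ k, l k ∈ Set.Ioo (0 : ℝ) 1) →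
    t ∈ Set.Ioo (0 : ℝ) 1 → Tendsto l atTop (𝓝 t) →
    Tendsto (fun k => comb ![l k, 1 - l k] ![u, v]) atTop (𝓝 (comb ![t, 1 - t] ![u, v]))
  /-- negative curvature -/
  dist_comb_le : ∀ (u₁ u₂ v₁ v₂ : E) (t : ℝ), t ∈ Set.Ioo (0 : ℝ) 1 →
    dist (comb ![t, 1 - t] ![u₁, u₂]) (comb ![t, 1 - t] ![v₁, v₂])
      ≤ t * dist u₁ v₁ + (1 - t) * dist u₂ v₂
  /-- convexification -/
  exists_convexification : ∀ u : E, ∃ k : E,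
    Tendsto (fun n : ℕ => comb (fun _ : Fin n => (n : ℝ)⁻¹) (fun _ : Fin n => u)) atTop (𝓝 k)

namespace CCSpace

variable {Ω E : Type*} [MetricSpace E]

/-- The convexification operator `K u = lim [1/n, u; …; 1/n, u]`. -/
def convexify [CCSpace E] (u : E) : E :=
  Classical.choose (exists_convexification u)

theorem convexify_spec [CCSpace E] (u : E) :
    Tendsto (fun n : ℕ => comb (fun _ : Fin n => (n : ℝ)⁻¹) (fun _ : Fin n => u)) atTop
      (𝓝 (convexify u)) :=
  Classical.choose_spec (exists_convexification u)

/-- Convex combination `[w i, u i]_{i ∈ s}` over a finite index set with nonnegative weights that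
sum to one: indices of weight zero are dropped. By commutativity the enumeration of the remaining
indices is irrelevant. -/
def combOn [CCSpace E] {ι : Type*} (s : Finset ι) (w : ι → ℝ) (u : ι → E) : E :=
  open Classical in
  let J : Finset ι := s.filter fun i => 0 < w i
  comb (fun k : Fin J.card => w (J.equivFin.symm k)) (fun k : Fin J.card => u (J.equivFin.symm k))

variable [MeasurableSpace E]

/-- Conditional expectation of a simple random element `S` with values `x₁, …, xₙ`:
`E(S | G) = [E(1_{S = xᵢ} | G), K xᵢ]`. -/
def simpleCondExp [CCSpace E] (G : MeasurableSpace Ω) {mΩ : MeasurableSpace Ω} (μ : Measure Ω)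
    (S : SimpleFunc Ω E) (ω : Ω) : E :=
  combOn S.range (fun x => (μ[(S ⁻¹' {x}).indicator (fun _ => (1 : ℝ)) | G]) ω)
    (fun x => convexify x)

/-- `Y` is (a version of) the conditional expectation `E(X | G)`: `Y` is `G`-measurable and, almost
surely, `Y = lim E(ψₙ(X) | G)`. Here `ψₙ = SimpleFunc.nearestPt u n` sends a point `x` to the
nearest of the points `u 0, …, u n`, the one of least index in case of ties. -/
def IsCondExp [CCSpace E] [BorelSpace E] (u : ℕ → E) (G : MeasurableSpace Ω)
    {mΩ : MeasurableSpace Ω} (μ : Measure Ω) (X : Ω → E) (hX : Measurable X) (Y : Ω → E) : Prop :=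
  Measurable[G] Y ∧
    ∀ᵐ ω ∂μ, Tendsto (fun n : ℕ => simpleCondExp G μ ((SimpleFunc.nearestPt u n).comp X hX) ω)
      atTop (𝓝 (Y ω))

/-- `X ∈ L^p_E(G)`: `X` is `G`-measurable and `d(a, X)^p` is integrable for some `a`. -/
def MemLpE (p : ℝ) (G : MeasurableSpace Ω) {mΩ : MeasurableSpace Ω} (μ : Measure Ω)
    (X : Ω → E) : Prop :=
  Measurable[G] X ∧ ∃ a : E, Integrable (fun ω => dist a (X ω) ^ p) μ

/-- The distance `Δ_p(X, Y) = (E d(X, Y)^p)^{1/p}`, with values in `[0, ∞]`. -/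
def lpDist {mΩ : MeasurableSpace Ω} (p : ℝ) (μ : Measure Ω) (X Y : Ω → E) : ENNReal :=
  (∫⁻ ω, edist (X ω) (Y ω) ^ p ∂μ) ^ (1 / p)

end CCSpace

end

/-! Two estimates reduce everything to real conditional expectations. Points `K x` satisfy [t, Kx; 1
- t, Kx] = Kx (`isConvexPt_convexify`), so in a combination of them equal entries may be merged or
split, and only the total weight given to each point matters. Writing two combinations over a common
coupling and using nonexpansiveness for fixed weights yields a Wasserstein-type bound
(`dist_combOn_le_of_coupling`). Coupling by the conditional joint law of S and T gives d(E(S|G),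
E(T|G)) ≤ E(d(S,T)|G) (`dist_simpleCondExp_le`). Coupling that leaves the common mass in place shows
that, for fixed S, E(S|G) is Lipschitz in the conditional probabilities (`dist_combOn_weights_le`).

The first estimate makes E(ψₙ(X)|G) a.s. Cauchy, because E(d(ψₙ(X),X)|G) decreases to 0, and gives
d(E(ψₘ(X)|G), E(X|G)) ≤ E(d(ψₘ(X),X)|G). Along a sequence of σ-algebras, the distance to the limit
is then at most two such errors plus a term for the simple element ψₘ(X). For fixed m the second
estimate and real martingale convergence send that term to 0. The errors are controlled by real
convergence again (a.s.), or by the L^p contraction of real conditional expectation.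

The direction of the sequence thus enters only through the real theorem: Lévy's upward theorem, or
the downward one (`tendsto_ae_condExp_iInf`), obtained from L² projections, density in L¹ and a
time-reversed maximal inequality. -/

namespace CCSpace

/-! ### Block associativity, nonexpansiveness, and convexity of the points `K u`. -/

section Algebra

variable {E : Type*} [MetricSpace E] [CCSpace E]

theorem comb_reindex {m n : ℕ} (e : Fin m ≃ Fin n) {w : Fin n → ℝ} (hw : IsWeight w)
    (u : Fin n → E) : comb (fun i => w (e i)) (fun i => u (e i)) = comb w u := by
  obtain rfl : m = n := Fin.equiv_iff_eq.1 ⟨e⟩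
  exact comb_perm w u e hw

theorem comb_fin_one {w : Fin 1 → ℝ} (hw : IsWeight w) (u : Fin 1 → E) : comb w u = u 0 := by
  have h1 : w = ![1] := by
    ext i
    have := hw.2
    fin_cases i
    simpa using this
  have h2 : u = ![u 0] := by
    ext i
    fin_cases i
    rfl
  rw [h1, h2, comb_one]
  rfl

theorem dist_comb_two_le {a b : ℝ} (ha : 0 < a) (hb : 0 < b) (hab : a + b = 1)
    (u₁ u₂ v₁ v₂ : E) :
    dist (comb ![a, b] ![u₁, u₂]) (comb ![a, b] ![v₁, v₂]) ≤ a * dist u₁ v₁ + b * dist u₂ v₂ := by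
  obtain rfl : b = 1 - a := by linarith
  exact dist_comb_le u₁ u₂ v₁ v₂ a ⟨ha, by linarith⟩

theorem isWeight_merge {n : ℕ} {w : Fin (n + 2) → ℝ} (hw : IsWeight w) :
    IsWeight (Fin.snoc (α := fun _ => ℝ) (fun i : Fin n => w i.castSucc.castSucc)
      (w (Fin.last n).castSucc + w (Fin.last (n + 1)))) := by
  refine ⟨fun i => ?_, ?_⟩
  · refine Fin.lastCases ?_ (fun i => ?_) i
    · simpa using add_pos (hw.1 _) (hw.1 _)
    · simpa using hw.1 _
  · have := hw.2
    rw [Fin.sum_univ_castSucc, Fin.sum_univ_castSucc] at this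
    rw [Fin.sum_univ_castSucc]
    simp only [Fin.snoc_castSucc, Fin.snoc_last]
    linarith

/-- The operation is nonexpansive for fixed weights. -/
theorem dist_comb_le_sum : ∀ {n : ℕ} {w : Fin n → ℝ}, IsWeight w → ∀ u v : Fin n → E,
    dist (comb w u) (comb w v) ≤ ∑ i, w i * dist (u i) (v i)
  | 0, w, hw, _, _ => by simpa using hw.2
  | 1, w, hw, u, v => by
    have := hw.2
    rw [comb_fin_one hw, comb_fin_one hw]
    simp only [Fin.sum_univ_one] at this ⊢
    rw [this, one_mul]
  | n + 2, w, hw, u, v => by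
    rw [comb_assoc w u hw, comb_assoc w v hw]
    refine (dist_comb_le_sum (isWeight_merge hw) _ _).trans ?_
    have hp := hw.1 (Fin.last n).castSucc
    have hq := hw.1 (Fin.last (n + 1))
    have hpq := add_pos hp hq
    have h := dist_comb_two_le (div_pos hp hpq) (div_pos hq hpq)
      (by field_simp) (u (Fin.last n).castSucc) (u (Fin.last (n + 1)))
      (v (Fin.last n).castSucc) (v (Fin.last (n + 1)))
    rw [Fin.sum_univ_castSucc, Fin.sum_univ_castSucc (n := n + 1), Fin.sum_univ_castSucc (n := n)]
    simp only [Fin.snoc_castSucc, Fin.snoc_last]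
    rw [add_assoc]
    gcongr
    calc _ ≤ (w (Fin.last n).castSucc + w (Fin.last (n + 1))) * _ :=
          mul_le_mul_of_nonneg_left h hpq.le
      _ = _ := by field_simp

theorem isWeight_div_sum {n : ℕ} {w : Fin n → ℝ} (hw : ∀ i, 0 < w i) (hn : 0 < n) :
    IsWeight fun i => w i / ∑ j, w j := by
  have : Nonempty (Fin n) := ⟨⟨0, hn⟩⟩
  have : 0 < ∑ j, w j := Finset.sum_pos (fun i _ => hw i) Finset.univ_nonempty
  exact ⟨fun i => div_pos (hw i) this, by rw [← Finset.sum_div, div_self this.ne']⟩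


theorem comb_snoc_snoc {n : ℕ} {w : Fin n → ℝ} {p q : ℝ} (u : Fin n → E) (y z : E)
    (h : IsWeight (Fin.snoc (α := fun _ => ℝ) (Fin.snoc (α := fun _ => ℝ) w p) q)) :
    comb (Fin.snoc (α := fun _ => ℝ) (Fin.snoc (α := fun _ => ℝ) w p) q)
        (Fin.snoc (α := fun _ => E) (Fin.snoc (α := fun _ => E) u y) z) =
      comb (Fin.snoc (α := fun _ => ℝ) w (p + q))
        (Fin.snoc (α := fun _ => E) u (comb ![p / (p + q), q / (p + q)] ![y, z])) := by
  rw [comb_assoc _ _ h]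
  simp only [Fin.snoc_castSucc, Fin.snoc_last]

theorem isWeight_snoc_add {n : ℕ} {w : Fin n → ℝ} {p q : ℝ}
    (h : IsWeight (Fin.snoc (α := fun _ => ℝ) (Fin.snoc (α := fun _ => ℝ) w p) q)) :
    IsWeight (Fin.snoc (α := fun _ => ℝ) w (p + q)) := by
  simpa only [Fin.snoc_castSucc, Fin.snoc_last] using isWeight_merge h

/-- A final block of a convex combination can be replaced by its own convex combination. -/
theorem comb_append_eq_snoc {a : ℕ} (w : Fin a → ℝ) (u : Fin a → E) :
    ∀ {b : ℕ} (v : Fin (b + 1) → ℝ) (x : Fin (b + 1) → E), IsWeight (Fin.append w v) →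
      comb (Fin.append w v) (Fin.append u x) =
        comb (Fin.snoc (α := fun _ => ℝ) w (∑ j, v j))
          (Fin.snoc (α := fun _ => E) u (comb (fun i => v i / ∑ j, v j) x))
  | 0, v, x, h => by
    have hv : ∀ i, 0 < v i := fun i => by simpa using h.1 (Fin.natAdd a i)
    rw [comb_fin_one (isWeight_div_sum hv one_pos), Fin.append_right_eq_snoc,
      Fin.append_right_eq_snoc]
    simp
  | b + 1, v, x, h => by
    have hv : ∀ i, 0 < v i := fun i => by simpa using h.1 (Fin.natAdd a i)
    obtain ⟨v, q, rfl⟩ : ∃ v' q, v = Fin.snoc (α := fun _ => ℝ) v' q :=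
      ⟨_, _, (Fin.snoc_init_self (α := fun _ => ℝ) v).symm⟩
    obtain ⟨v, p, rfl⟩ : ∃ v' q, v = Fin.snoc (α := fun _ => ℝ) v' q :=
      ⟨_, _, (Fin.snoc_init_self (α := fun _ => ℝ) v).symm⟩
    obtain ⟨x, z, rfl⟩ : ∃ v' q, x = Fin.snoc (α := fun _ => E) v' q :=
      ⟨_, _, (Fin.snoc_init_self (α := fun _ => E) x).symm⟩
    obtain ⟨x, y, rfl⟩ : ∃ v' q, x = Fin.snoc (α := fun _ => E) v' q :=
      ⟨_, _, (Fin.snoc_init_self (α := fun _ => E) x).symm⟩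
    rw [Fin.append_snoc, Fin.append_snoc] at h
    have hV := isWeight_div_sum hv (Nat.succ_pos _)
    have hV0 : 0 < ∑ j, (Fin.snoc (α := fun _ => ℝ) (Fin.snoc (α := fun _ => ℝ) v p) q :
        Fin (b + 2) → ℝ) j := Finset.sum_pos (fun i _ => hv i) Finset.univ_nonempty
    have hS : ∑ j, (Fin.snoc (α := fun _ => ℝ) v (p + q) : Fin (b + 1) → ℝ) j =
        ∑ j, (Fin.snoc (α := fun _ => ℝ) (Fin.snoc (α := fun _ => ℝ) v p) q :
          Fin (b + 2) → ℝ) j := by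
      simp [Fin.sum_univ_castSucc, add_assoc]
    have h' := isWeight_snoc_add h
    -- Associativity merges the last two entries, and the induction hypothesis collapses the
    -- shortened block. It remains to undo the merge inside the normalised block, where the factor
    -- `V` cancels from the proportions.
    rw [Fin.append_snoc, Fin.append_snoc, Fin.append_snoc, Fin.append_snoc, comb_snoc_snoc _ _ _ h,
      ← Fin.append_snoc, ← Fin.append_snoc, comb_append_eq_snoc _ _ _ _ (by rwa [Fin.append_snoc]),
      hS]
    congr 2
    set V := ∑ j, (Fin.snoc (α := fun _ => ℝ) (Fin.snoc (α := fun _ => ℝ) v p) q :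
          Fin (b + 2) → ℝ) j
    have e : (fun i => (Fin.snoc (α := fun _ => ℝ) (Fin.snoc (α := fun _ => ℝ) v p) q :
          Fin (b + 2) → ℝ) i / V) = Fin.snoc (α := fun _ => ℝ)
            (Fin.snoc (α := fun _ => ℝ) (fun i => v i / V) (p / V)) (q / V) := by
      ext i
      refine Fin.lastCases ?_ (fun i => ?_) i
      · simp
      · refine Fin.lastCases ?_ (fun i => ?_) i <;> simp
    rw [e] at hV ⊢
    rw [comb_snoc_snoc _ _ _ hV]
    congr 1
    · ext i
      refine Fin.lastCases ?_ (fun i => ?_) i <;> simp [add_div]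
    · have hp : 0 < p := by simpa using hv (Fin.last b).castSucc
      have hq : 0 < q := by simpa using hv (Fin.last (b + 1))
      have h1 : p / V / (p / V + q / V) = p / (p + q) := by field_simp
      have h2 : q / V / (p / V + q / V) = q / (p + q) := by field_simp
      rw [h1, h2]

/-- The bijection that moves the last index to the front. -/
def lastToFront (a : ℕ) : Fin (1 + a) ≃ Fin (a + 1) :=
  finSumFinEquiv.symm.trans ((Equiv.sumComm _ _).trans finSumFinEquiv)

theorem append_eq_snoc_comp_lastToFront {α : Type*} {a : ℕ} (w : Fin a → α) (p : α) :
    Fin.append (fun _ : Fin 1 => p) w =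
      fun i => (Fin.snoc (α := fun _ => α) w p : Fin (a + 1) → α) (lastToFront a i) := by
  ext i
  refine Fin.addCases (fun i => ?_) (fun i => ?_) i
  · have : lastToFront a (Fin.castAdd a i) = Fin.last a := by
      simp [lastToFront, Fin.ext_iff]
    rw [this]; simp
  · have : lastToFront a (Fin.natAdd 1 i) = i.castSucc := by
      simp [lastToFront, Fin.ext_iff]
    rw [this]; simp

/-- A convex combination of two blocks is the convex combination of their combinations. -/
theorem comb_append {a b : ℕ} (w : Fin (a + 1) → ℝ) (u : Fin (a + 1) → E)
    (v : Fin (b + 1) → ℝ) (x : Fin (b + 1) → E) (h : IsWeight (Fin.append w v)) :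
    comb (Fin.append w v) (Fin.append u x) =
      comb ![∑ j, v j, ∑ j, w j]
        ![comb (fun i => v i / ∑ j, v j) x, comb (fun i => w i / ∑ j, w j) u] := by
  have hw : ∀ i, 0 < w i := fun i => by simpa using h.1 (Fin.castAdd _ i)
  have hv : ∀ i, 0 < v i := fun i => by simpa using h.1 (Fin.natAdd _ i)
  have h1 : ∑ i, w i + ∑ i, v i = 1 := by simpa [Fin.sum_univ_add] using h.2
  have h2 : IsWeight (Fin.snoc (α := fun _ => ℝ) w (∑ j, v j)) := by
    refine ⟨fun i => ?_, by simpa [Fin.sum_univ_castSucc (n := a + 1)] using h1⟩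
    refine Fin.lastCases ?_ (fun i => ?_) i
    · simpa using Finset.sum_pos (fun i _ => hv i) Finset.univ_nonempty
    · simpa using hw i
  have h3 : IsWeight (Fin.append (fun _ : Fin 1 => ∑ j, v j) w) := by
    rw [append_eq_snoc_comp_lastToFront]
    exact ⟨fun i => h2.1 _, by rw [Equiv.sum_comp (lastToFront (a + 1))]; exact h2.2⟩
  -- Collapse the second block to one point, rotate that point to the front, and collapse the first
  -- block, which is now final. This is why the two blocks come out in reverse order.
  rw [comb_append_eq_snoc w u v x h, ← comb_reindex (lastToFront (a + 1)) h2,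
    ← append_eq_snoc_comp_lastToFront, ← append_eq_snoc_comp_lastToFront,
    comb_append_eq_snoc _ _ _ _ h3]
  congr 1 <;>
  · ext i
    fin_cases i <;> rfl

/-- A point `x` is convex if `[t, x; 1 - t, x] = x` for all `t`. -/
def IsConvexPt (x : E) : Prop :=
  ∀ a b : ℝ, 0 < a → 0 < b → a + b = 1 → comb ![a, b] ![x, x] = x

/-- The uniform combination of `n` copies of `u`. -/
noncomputable abbrev uniformComb (n : ℕ) (u : E) : E :=
  comb (fun _ : Fin n => (n : ℝ)⁻¹) (fun _ : Fin n => u)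

theorem isWeight_uniform {n : ℕ} (hn : 0 < n) : IsWeight fun _ : Fin n => (n : ℝ)⁻¹ := by
  have : (0 : ℝ) < n := by exact_mod_cast hn
  exact ⟨fun _ => inv_pos.2 this, by simp [this.ne']⟩

/-- Each block of a uniform combination is uniform after normalisation; the summands `+ 1` keep both
blocks nonempty. -/
theorem uniformComb_add (a b : ℕ) (u : E) :
    uniformComb (a + 1 + (b + 1)) u =
      comb ![(b + 1 : ℝ) / (a + 1 + (b + 1)), (a + 1 : ℝ) / (a + 1 + (b + 1))]
        ![uniformComb (b + 1) u, uniformComb (a + 1) u] := by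
  have e : ∀ {α : Type _} (c : α), (fun _ : Fin (a + 1 + (b + 1)) => c) =
      Fin.append (fun _ => c) (fun _ => c) := by
    intro α c
    ext i
    refine Fin.addCases (fun i => ?_) (fun i => ?_) i <;> simp
  have e' : (fun _ : Fin (a + 1 + (b + 1)) => u) = Fin.append (fun _ => u) (fun _ => u) := by
    ext i
    refine Fin.addCases (fun i => ?_) (fun i => ?_) i <;> simp
  have h := isWeight_uniform (n := a + 1 + (b + 1)) (by omega)
  rw [e] at h
  have hc : ((a : ℝ) + 1 + (b + 1)) ≠ 0 := by positivity
  have ha : ((a : ℝ) + 1) ≠ 0 := by positivity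
  have hb : ((b : ℝ) + 1) ≠ 0 := by positivity
  rw [uniformComb, e, e', comb_append _ _ _ _ h]
  simp only [Finset.sum_const, Finset.card_univ, Fintype.card_fin, nsmul_eq_mul, uniformComb]
  push_cast
  have h1 : ((a : ℝ) + 1 + (b + 1))⁻¹ / ((b + 1) * ((a : ℝ) + 1 + (b + 1))⁻¹) = (b + 1 : ℝ)⁻¹ := by
    field_simp
  have h2 : ((a : ℝ) + 1 + (b + 1))⁻¹ / ((a + 1) * ((a : ℝ) + 1 + (b + 1))⁻¹) = (a + 1 : ℝ)⁻¹ := by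
    field_simp
  rw [h1, h2, ← div_eq_mul_inv, ← div_eq_mul_inv]

/-- Split (k + 1)(a + b + 2) copies of `u` into blocks of sizes (k + 1)(b + 1) and (k + 1)(a + 1).
The weights do not depend on `k`, so as k → ∞ nonexpansiveness lets the blocks be replaced by their
limit `K u`, which is also the limit of the whole. -/
theorem comb_two_convexify_of_nat (a b : ℕ) (u : E) :
    comb ![(b + 1 : ℝ) / (a + 1 + (b + 1)), (a + 1 : ℝ) / (a + 1 + (b + 1))]
      ![convexify u, convexify u] = convexify u := by
  have hK := convexify_spec u
  have hlim : ∀ c : ℕ, Tendsto (fun k : ℕ => uniformComb ((k + 1) * (c + 1)) u) atTop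
      (𝓝 (convexify u)) := fun c => hK.comp (tendsto_atTop_mono
        (fun k => show k ≤ (k + 1) * (c + 1) by nlinarith) tendsto_id)
  have hadd : ∀ k : ℕ, uniformComb ((k + 1) * ((a + 1 + b) + 1)) u =
      comb ![(b + 1 : ℝ) / (a + 1 + (b + 1)), (a + 1 : ℝ) / (a + 1 + (b + 1))]
        ![uniformComb ((k + 1) * (b + 1)) u, uniformComb ((k + 1) * (a + 1)) u] := by
    intro k
    obtain ⟨a', ha'⟩ : ∃ a', (k + 1) * (a + 1) = a' + 1 := ⟨(k + 1) * (a + 1) - 1, by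
      have : 0 < (k + 1) * (a + 1) := by positivity
      omega⟩
    obtain ⟨b', hb'⟩ : ∃ b', (k + 1) * (b + 1) = b' + 1 := ⟨(k + 1) * (b + 1) - 1, by
      have : 0 < (k + 1) * (b + 1) := by positivity
      omega⟩
    have hs : (k + 1) * ((a + 1 + b) + 1) = a' + 1 + (b' + 1) := by
      rw [← ha', ← hb']; ring
    have hk : (k : ℝ) + 1 ≠ 0 := by positivity
    have ha : (a' : ℝ) + 1 = (k + 1) * (a + 1) := by exact_mod_cast ha'.symm
    have hb : (b' : ℝ) + 1 = (k + 1) * (b + 1) := by exact_mod_cast hb'.symm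
    rw [hs, ha', hb', uniformComb_add, ha, hb, ← mul_add, mul_div_mul_left _ _ hk,
      mul_div_mul_left _ _ hk]
  have h1 : Tendsto (fun k : ℕ => comb
      ![(b + 1 : ℝ) / (a + 1 + (b + 1)), (a + 1 : ℝ) / (a + 1 + (b + 1))]
        ![uniformComb ((k + 1) * (b + 1)) u, uniformComb ((k + 1) * (a + 1)) u]) atTop
      (𝓝 (comb ![(b + 1 : ℝ) / (a + 1 + (b + 1)), (a + 1 : ℝ) / (a + 1 + (b + 1))]
      ![convexify u, convexify u])) := by
    rw [tendsto_iff_dist_tendsto_zero]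
    refine squeeze_zero (fun _ => dist_nonneg) (fun k => dist_comb_two_le (by positivity)
      (by positivity) (by field_simp; ring) _ _ _ _) ?_
    simpa using ((tendsto_iff_dist_tendsto_zero.1 (hlim b)).const_mul _).add
      ((tendsto_iff_dist_tendsto_zero.1 (hlim a)).const_mul _)
  simp_rw [← hadd] at h1
  exact tendsto_nhds_unique h1 (hlim _)

/-- Rational weights are covered by splitting uniform combinations; continuity in the weight extends
this to all of (0, 1). -/
theorem isConvexPt_convexify (u : E) : IsConvexPt (convexify u) := by
  intro t b ht hb htb
  obtain rfl : b = 1 - t := by linarith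
  have ht' : t ∈ Set.Ioo (0 : ℝ) 1 := ⟨ht, by linarith⟩
  have hd : t ∈ closure (Set.Ioo (0 : ℝ) 1 ∩ Set.range ((↑) : ℚ → ℝ)) :=
    Rat.denseRange_cast.open_subset_closure_inter isOpen_Ioo ht'
  obtain ⟨l, hl, hlt⟩ := mem_closure_iff_seq_limit.1 hd
  refine tendsto_nhds_unique (comb_tendsto (convexify u) (convexify u) l t
    (fun k => (hl k).1) ht' hlt) ?_
  refine tendsto_const_nhds.congr fun k => ?_
  obtain ⟨⟨h0, h1⟩, q, hq⟩ := hl k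
  rw [← hq] at h0 h1 ⊢
  have h0' : 0 < q := by exact_mod_cast h0
  have h1' : q < 1 := by exact_mod_cast h1
  have hn0 : 0 < q.num := Rat.num_pos.2 h0'
  have hnd : q.num < q.den := Rat.num_lt_denom_iff.2 h1'
  -- For q = num / den the blocks have sizes num = b + 1 and den - num = a + 1, both positive since
  -- 0 < q < 1.
  obtain ⟨b, hb⟩ : ∃ b : ℕ, q.num = b + 1 := ⟨(q.num - 1).toNat, by omega⟩
  obtain ⟨a, ha⟩ : ∃ a : ℕ, (q.den : ℤ) = a + 1 + (b + 1) :=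
    ⟨(q.den - q.num - 1).toNat, by omega⟩
  have hq' : (q : ℝ) = (b + 1) / (a + 1 + (b + 1)) := by
    have e1 : (q.num : ℝ) = b + 1 := by exact_mod_cast hb
    have e2 : (q.den : ℝ) = a + 1 + (b + 1) := by exact_mod_cast ha
    rw [Rat.cast_def, e1, e2]
  have hc : ((a : ℝ) + 1 + (b + 1)) ≠ 0 := by positivity
  have hq'' : 1 - (q : ℝ) = (a + 1) / (a + 1 + (b + 1)) := by
    rw [hq']; field_simp; ring
  rw [hq'', hq', comb_two_convexify_of_nat]

theorem dist_convexify_le (u v : E) : dist (convexify u) (convexify v) ≤ dist u v := by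
  refine le_of_tendsto ((convexify_spec u).dist (convexify_spec v)) ?_
  filter_upwards [eventually_gt_atTop 0] with n hn
  refine (dist_comb_le_sum (isWeight_uniform hn) _ _).trans ?_
  rw [← Finset.sum_mul, (isWeight_uniform hn).2, one_mul]

end Algebra

end CCSpace

namespace CCSpace

/-! ### Combinations over finite sets: merging convex points, couplings, dependence on the weights.
-/

section CombOn

variable {E : Type*} [MetricSpace E] [CCSpace E] {ι κ κ' : Type*}

open Classical in
theorem sum_equivFin_symm_filter (s : Finset ι) {w : ι → ℝ} (hw : ∀ i ∈ s, 0 ≤ w i) (g : ι → ℝ)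
    (hg : ∀ i ∈ s, w i = 0 → g i = 0) :
    ∑ k, g ((s.filter fun i => 0 < w i).equivFin.symm k) = ∑ i ∈ s, g i := by
  rw [Equiv.sum_comp (s.filter fun i => 0 < w i).equivFin.symm (fun i => g i),
    Finset.sum_coe_sort (s.filter fun i => 0 < w i) g, Finset.sum_filter]
  refine Finset.sum_congr rfl fun i hi => ?_
  split_ifs with h
  · rfl
  · exact (hg i hi (le_antisymm (not_lt.1 h) (hw i hi))).symm

open Classical in
theorem isWeight_equivFin_symm {s : Finset ι} {w : ι → ℝ} (hw : ∀ i ∈ s, 0 ≤ w i)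
    (hs : ∑ i ∈ s, w i = 1) :
    IsWeight fun k => w ((s.filter fun i => 0 < w i).equivFin.symm k) :=
  ⟨fun k => (Finset.mem_filter.1 ((s.filter fun i => 0 < w i).equivFin.symm k).2).2, by
    rw [sum_equivFin_symm_filter s hw w (fun _ _ h => h), hs]⟩

/-- The enumeration used in `combOn` is irrelevant. -/
theorem combOn_eq_comb {s : Finset ι} {w : ι → ℝ} {n : ℕ} (f : Fin n → ι) (hf : f.Injective)
    (hfs : ∀ i, f i ∈ s) (hsf : ∀ k ∈ s, 0 < w k → ∃ i, f i = k) (hw : IsWeight fun i => w (f i))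
    (u : ι → E) : combOn s w u = comb (fun i => w (f i)) (fun i => u (f i)) := by
  classical
  unfold combOn
  dsimp only
  set J := s.filter fun i => 0 < w i with hJ
  have hmem : ∀ i, f i ∈ J := fun i => by
    rw [hJ, Finset.mem_filter]
    exact ⟨hfs i, hw.1 i⟩
  let g : Fin n → J := fun i => ⟨f i, hmem i⟩
  have hg : g.Bijective := by
    refine ⟨fun i j h => hf (congrArg Subtype.val h), fun k => ?_⟩
    obtain ⟨i, hi⟩ := hsf k (Finset.mem_filter.1 k.2).1 (Finset.mem_filter.1 k.2).2
    exact ⟨i, Subtype.ext hi⟩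
  let e : Fin J.card ≃ Fin n := J.equivFin.symm.trans (Equiv.ofBijective g hg).symm
  have he : ∀ k, f (e k) = J.equivFin.symm k := fun k => by
    change ((g (e k) : J) : ι) = _
    congr 1
    exact (Equiv.ofBijective g hg).apply_symm_apply _
  rw [← comb_reindex e hw]
  simp only [he]

/-- The length and enumeration inside `combOn` depend on the weight function, so the enumeration
belonging to `w` is reused for `w'`. -/
theorem combOn_congr {s : Finset ι} {w w' : ι → ℝ} (hw : ∀ i ∈ s, 0 ≤ w i)
    (hs : ∑ i ∈ s, w i = 1) (h : ∀ i ∈ s, w i = w' i) (u : ι → E) :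
    combOn s w u = combOn s w' u := by
  classical
  set J := s.filter fun i => 0 < w i with hJ
  have hmem : ∀ k : J, (k : ι) ∈ s := fun k => (Finset.mem_filter.1 k.2).1
  have h' : ∀ k, w (J.equivFin.symm k) = w' (J.equivFin.symm k) := fun k => h _ (hmem _)
  have hW := isWeight_equivFin_symm hw hs
  rw [combOn_eq_comb (s := s) (w := w') (fun k => (J.equivFin.symm k : ι))]
  · unfold combOn
    dsimp only
    rw [← hJ]
    simp only [h']
  · exact Subtype.val_injective.comp J.equivFin.symm.injective
  · exact fun k => hmem _
  · intro k hk hk'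
    exact ⟨J.equivFin ⟨k, by rw [hJ, Finset.mem_filter, h k hk]; exact ⟨hk, hk'⟩⟩, by simp⟩
  · rw [← hJ] at hW
    simpa only [← h'] using hW

theorem dist_combOn_le_sum {s : Finset ι} {w : ι → ℝ} (hw : ∀ i ∈ s, 0 ≤ w i)
    (hs : ∑ i ∈ s, w i = 1) (u v : ι → E) :
    dist (combOn s w u) (combOn s w v) ≤ ∑ i ∈ s, w i * dist (u i) (v i) := by
  classical
  refine (dist_comb_le_sum (isWeight_equivFin_symm hw hs) _ _).trans_eq ?_
  exact sum_equivFin_symm_filter s hw (fun i => w i * dist (u i) (v i))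
    (fun i _ h => by simp [h])

/-- The associativity axiom acts only on the last two slots; this brings any two entries there. -/
theorem exists_perm_last_two {n : ℕ} {i j : Fin (n + 2)} (hij : i ≠ j) :
    ∃ σ : Equiv.Perm (Fin (n + 2)), σ (Fin.last n).castSucc = i ∧ σ (Fin.last (n + 1)) = j := by
  have hne : (Fin.last n).castSucc ≠ Fin.last (n + 1) := (Fin.castSucc_lt_last _).ne
  set i' := Equiv.swap j (Fin.last (n + 1)) i with hi'
  have h : Fin.last (n + 1) ≠ i' := by
    intro h
    apply hij
    have := congrArg (Equiv.swap j (Fin.last (n + 1))) h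
    rw [hi', Equiv.swap_apply_self, Equiv.swap_apply_right] at this
    exact this.symm
  refine ⟨Equiv.swap j (Fin.last (n + 1)) * Equiv.swap i' (Fin.last n).castSucc, ?_, ?_⟩
  · rw [Equiv.Perm.mul_apply, Equiv.swap_apply_right, hi', Equiv.swap_apply_self]
  · rw [Equiv.Perm.mul_apply, Equiv.swap_apply_of_ne_of_ne h hne.symm, Equiv.swap_apply_right]

open Classical in
/-- In a convex combination, equal convex points can be merged. -/
theorem comb_comp_eq_combOn (s : Finset κ) {x : κ → E} (hx : ∀ k, IsConvexPt (x k)) :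
    ∀ {n : ℕ} {w : Fin n → ℝ} (f : Fin n → κ), IsWeight w → (∀ i, f i ∈ s) →
      comb w (fun i => x (f i)) = combOn s (fun k => ∑ i, if f i = k then w i else 0) x := by
  intro n
  induction n with
  | zero => intro w f hw; simpa using hw.2
  | succ n ih =>
  intro w f hw hfs
  by_cases hf : f.Injective
  · have e : ∀ i, (∑ j, if f j = f i then w j else 0) = w i := fun i => by
      simp [hf.eq_iff]
    rw [combOn_eq_comb f hf hfs]
    · simp only [e]
    · intro k _ hk
      by_contra! h
      simp [h] at hk
    · simpa only [e] using hw
  -- Two slots carry the same label: move them to the end and merge them. Convexity of the point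
  -- makes the inner combination that point itself, and the length drops by one.
  · simp only [Function.Injective, not_forall] at hf
    obtain ⟨i, j, hfij, hij⟩ := hf
    cases n with
    | zero => exact absurd (Subsingleton.elim (α := Fin 1) i j) hij
    | succ n =>
    obtain ⟨σ, hi, hj⟩ := exists_perm_last_two hij
    have hw' : IsWeight fun k => w (σ k) :=
      ⟨fun k => hw.1 _, by rw [Equiv.sum_comp σ w]; exact hw.2⟩
    have hp := hw.1 i
    have hq := hw.1 j
    have hpq := add_pos hp hq
    set f' : Fin (n + 1) → κ := Fin.snoc (α := fun _ => κ)
      (fun k : Fin n => f (σ k.castSucc.castSucc)) (f j) with hf'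
    rw [← comb_perm w _ σ hw, comb_assoc _ _ hw', hi, hj, hfij,
      hx (f j) _ _ (div_pos hp hpq) (div_pos hq hpq) (by field_simp)]
    have e : (Fin.snoc (α := fun _ => E) (fun k : Fin n => x (f (σ k.castSucc.castSucc))) (x (f j)))
        = fun k => x (f' k) := by
      ext k
      refine Fin.lastCases ?_ (fun k => ?_) k <;> simp [hf']
    have hW := isWeight_merge hw'
    rw [hi, hj] at hW
    rw [e, ih f' hW]
    · congr 1
      ext k
      rw [← Equiv.sum_comp σ, Fin.sum_univ_castSucc, Fin.sum_univ_castSucc (n := n + 1),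
        Fin.sum_univ_castSucc (n := n)]
      simp only [hf', Fin.snoc_castSucc, Fin.snoc_last, hi, hj, hfij]
      split_ifs <;> ring
    · intro k
      refine Fin.lastCases ?_ (fun k => ?_) k <;> simp [hf', hfs]

/-- Convex combinations of convex points only depend on the image of the weights. -/
theorem combOn_comp {t : Finset ι} {s : Finset κ} {x : κ → E} (hx : ∀ k, IsConvexPt (x k))
    {γ : ι → ℝ} (hγ : ∀ i ∈ t, 0 ≤ γ i) (h1 : ∑ i ∈ t, γ i = 1) (f : ι → κ) (hf : ∀ i ∈ t, f i ∈ s)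
    {w : κ → ℝ} (hw : ∀ k, w k = ∑ i ∈ t, (open Classical in if f i = k then γ i else 0)) :
    combOn t γ (fun i => x (f i)) = combOn s w x := by
  classical
  obtain rfl : w = fun k => ∑ i ∈ t, if f i = k then γ i else 0 := funext fun k => by
    rw [hw]
  have h := comb_comp_eq_combOn s hx
    (fun k => f ((t.filter fun i => 0 < γ i).equivFin.symm k)) (isWeight_equivFin_symm hγ h1)
    (fun k => hf _ (Finset.mem_filter.1 ((t.filter fun i => 0 < γ i).equivFin.symm k).2).1)
  refine h.trans ?_
  congr 1
  ext k
  exact sum_equivFin_symm_filter t hγ (fun i => if f i = k then γ i else 0)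
    (fun i _ h => by simp [h])

/-- The distance of two convex combinations of convex points is bounded by the cost of any coupling
of the weights. -/
theorem dist_combOn_le_of_coupling {s : Finset κ} {s' : Finset κ'} {x : κ → E} {x' : κ' → E}
    (hx : ∀ k, IsConvexPt (x k)) (hx' : ∀ k, IsConvexPt (x' k)) {w : κ → ℝ} {w' : κ' → ℝ}
    {γ : κ → κ' → ℝ} (hγ : ∀ i ∈ s, ∀ j ∈ s', 0 ≤ γ i j) (h1 : ∑ i ∈ s, w i = 1)
    (hw : ∀ i ∈ s, w i = ∑ j ∈ s', γ i j) (hw' : ∀ j ∈ s', w' j = ∑ i ∈ s, γ i j) :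
    dist (combOn s w x) (combOn s' w' x') ≤ ∑ i ∈ s, ∑ j ∈ s', γ i j * dist (x i) (x' j) := by
  classical
  set t := s ×ˢ s'
  have hγ' : ∀ q ∈ t, 0 ≤ γ q.1 q.2 := fun q hq => by
    rw [Finset.mem_product] at hq
    exact hγ _ hq.1 _ hq.2
  have ht : ∑ q ∈ t, γ q.1 q.2 = 1 := by
    rw [Finset.sum_product, ← h1]
    exact Finset.sum_congr rfl fun i hi => (hw i hi).symm
  have h1' : ∑ j ∈ s', w' j = 1 := by
    rw [← ht, Finset.sum_product_right]
    exact Finset.sum_congr rfl fun i hi => (hw' i hi)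
  -- Both combinations are rewritten over `s ×ˢ s'` with the same weights `γ`, so that
  -- nonexpansiveness for fixed weights applies.
  have e1 : combOn s w x = combOn t (fun q => γ q.1 q.2) (fun q => x q.1) := by
    rw [combOn_comp (s := s) hx hγ' ht Prod.fst (fun q hq => (Finset.mem_product.1 hq).1)
      (fun _ => rfl)]
    refine combOn_congr (fun i hi => ?_) h1 (fun i hi => ?_) x
    · rw [hw i hi]
      exact Finset.sum_nonneg fun j hj => hγ i hi j hj
    · rw [hw i hi, Finset.sum_product_right]
      refine Finset.sum_congr rfl fun j _ => ?_
      rw [Finset.sum_ite_eq' s i (fun i => γ i j), if_pos hi]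
  have e2 : combOn s' w' x' = combOn t (fun q => γ q.1 q.2) (fun q => x' q.2) := by
    rw [combOn_comp (s := s') hx' hγ' ht Prod.snd (fun q hq => (Finset.mem_product.1 hq).2)
      (fun _ => rfl)]
    refine combOn_congr (fun i hi => ?_) h1' (fun i hi => ?_) x'
    · rw [hw' i hi]
      exact Finset.sum_nonneg fun j hj => hγ j hj i hi
    · rw [hw' i hi, Finset.sum_product]
      refine Finset.sum_congr rfl fun j _ => ?_
      rw [Finset.sum_ite_eq' s' i (fun i => γ j i), if_pos hi]
  rw [e1, e2, ← Finset.sum_product']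
  exact dist_combOn_le_sum hγ' ht _ _

/-- Convex combinations of finitely many convex points are Lipschitz in the weights. -/
theorem dist_combOn_weights_le {s : Finset κ} {x : κ → E} (hx : ∀ k, IsConvexPt (x k))
    {w w' : κ → ℝ} (hw : ∀ i ∈ s, 0 ≤ w i) (hw' : ∀ i ∈ s, 0 ≤ w' i) (h1 : ∑ i ∈ s, w i = 1)
    (h1' : ∑ i ∈ s, w' i = 1) {D : ℝ} (hD : ∀ i ∈ s, ∀ j ∈ s, dist (x i) (x j) ≤ D) :
    dist (combOn s w x) (combOn s w' x) ≤ D * ∑ i ∈ s, |w i - w' i| := by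
  classical
  -- The coupling leaves the common mass `m` on the diagonal, at no cost, and couples the residuals,
  -- both of mass `R`, by their product divided by `R`. Its cost is at most `D * R`; the case `R =
  -- 0` is separate because of the division.
  set m : κ → ℝ := fun i => min (w i) (w' i) with hm
  have hmw : ∀ i, 0 ≤ w i - m i := fun i => sub_nonneg.2 (min_le_left _ _)
  have hmw' : ∀ i, 0 ≤ w' i - m i := fun i => sub_nonneg.2 (min_le_right _ _)
  have hm0 : ∀ i ∈ s, 0 ≤ m i := fun i hi => le_min (hw i hi) (hw' i hi)
  set R := 1 - ∑ i ∈ s, m i with hR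
  have hwR : ∑ i ∈ s, (w i - m i) = R := by rw [Finset.sum_sub_distrib, h1]
  have hwR' : ∑ i ∈ s, (w' i - m i) = R := by rw [Finset.sum_sub_distrib, h1']
  have hRle : R ≤ ∑ i ∈ s, |w i - w' i| := by
    rw [← hwR]
    refine Finset.sum_le_sum fun i _ => ?_
    simp only [hm]
    rcases le_total (w i) (w' i) with h | h
    · rw [min_eq_left h, sub_self]; positivity
    · rw [min_eq_right h]; exact le_abs_self _
  have hD0 : 0 ≤ D := by
    obtain ⟨i, hi⟩ : s.Nonempty := by
      by_contra h
      rw [Finset.not_nonempty_iff_eq_empty] at h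
      simp [h] at h1
    exact dist_nonneg.trans (hD i hi i hi)
  have hR0 : 0 ≤ R := hwR ▸ Finset.sum_nonneg fun i _ => hmw i
  rcases hR0.eq_or_lt with hR0 | hR0
  · have h : ∀ i ∈ s, w i = w' i := by
      intro i hi
      have e1 := (Finset.sum_eq_zero_iff_of_nonneg fun i _ => hmw i).1 (hwR.trans hR0.symm) i hi
      have e2 := (Finset.sum_eq_zero_iff_of_nonneg fun i _ => hmw' i).1 (hwR'.trans hR0.symm) i hi
      linarith
    rw [combOn_congr hw h1 h, dist_self]
    positivity
  · have hγ := dist_combOn_le_of_coupling (s := s) (s' := s) hx hx (w := w) (w' := w')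
      (γ := fun i j => (if i = j then m i else 0) + (w i - m i) * (w' j - m j) / R)
      (fun i hi j _ => add_nonneg (by split_ifs <;> simp [hm0 i hi])
        (div_nonneg (mul_nonneg (hmw i) (hmw' j)) hR0.le)) h1
      (fun i hi => by
        rw [Finset.sum_add_distrib, Finset.sum_ite_eq, if_pos hi, ← Finset.sum_div,
          ← Finset.mul_sum, hwR', mul_div_cancel_right₀ _ hR0.ne']
        ring)
      (fun j hj => by
        rw [Finset.sum_add_distrib, Finset.sum_ite_eq', if_pos hj, ← Finset.sum_div,
          ← Finset.sum_mul, hwR, mul_div_cancel_left₀ _ hR0.ne']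
        ring)
    calc _ ≤ _ := hγ
      _ ≤ ∑ i ∈ s, ∑ j ∈ s, (w i - m i) * (w' j - m j) / R * D := by
        refine Finset.sum_le_sum fun i hi => Finset.sum_le_sum fun j hj => ?_
        by_cases hij : i = j
        · subst hij
          rw [dist_self, mul_zero]
          exact mul_nonneg (div_nonneg (mul_nonneg (hmw i) (hmw' i)) hR0.le) hD0
        · rw [if_neg hij, zero_add]
          exact mul_le_mul_of_nonneg_left (hD i hi j hj)
            (div_nonneg (mul_nonneg (hmw i) (hmw' j)) hR0.le)
      _ = D * R := by
        simp_rw [← Finset.sum_mul, ← Finset.sum_div, ← Finset.mul_sum, ← Finset.sum_mul, hwR, hwR']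
        field_simp
      _ ≤ _ := mul_le_mul_of_nonneg_left hRle hD0

end CombOn

end CCSpace

namespace MeasureTheory

/-! ### Lévy's downward theorem for real functions. -/

section Downward

variable {Ω : Type*} {mΩ : MeasurableSpace Ω} {μ : Measure Ω} {ℱ : ℕ → MeasurableSpace Ω}

theorem measurable_iInf_of_forall {β : Type*} [MeasurableSpace β] {f : Ω → β}
    (h : ∀ n, Measurable[ℱ n] f) : Measurable[⨅ n, ℱ n] f := fun _ hs =>
  MeasurableSpace.measurableSet_iInf.2 fun n => h n hs

/-- The limsup of versions measurable for the respective `ℱ n` depends only on tails, hence is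
measurable for every `ℱ k`. It is taken in `EReal`, where no boundedness is needed. -/
theorem aestronglyMeasurable_iInf_of_antitone (hℱ : Antitone ℱ) {f : Ω → ℝ}
    (h : ∀ n, AEStronglyMeasurable[ℱ n] f μ) : AEStronglyMeasurable[⨅ n, ℱ n] f μ := by
  choose g hg hfg using h
  let G : Ω → EReal := fun ω => limsup (fun n => (g n ω : EReal)) atTop
  have hG : Measurable[⨅ n, ℱ n] G := by
    refine measurable_iInf_of_forall fun k => ?_
    have : G = fun ω => limsup (fun n => (g (n + k) ω : EReal)) atTop := by
      ext ω
      exact (limsup_nat_add (fun n => (g n ω : EReal)) k).symm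
    rw [this]
    refine Measurable.limsup fun n => ?_
    exact measurable_coe_real_ereal.comp ((hg (n + k)).mono (hℱ (Nat.le_add_left k n))).measurable
  refine ⟨fun ω => (G ω).toReal,
    Measurable.stronglyMeasurable (measurable_ereal_toReal.comp hG), ?_⟩
  filter_upwards [ae_all_iff.2 hfg] with ω hω
  simp [G, ← hω]

/-- In L², conditional expectation is orthogonal projection onto a decreasing sequence of subspaces.
The orthogonal complements increase, so their projections converge, and subtracting from `f` gives
convergence of the original ones. -/
theorem tendsto_condExp_of_memLp_two [IsProbabilityMeasure μ] (hℱ : Antitone ℱ)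
    (hle : ∀ n, ℱ n ≤ mΩ) {f : Ω → ℝ} (hf : MemLp f 2 μ) :
    ∃ g : Ω → ℝ, Integrable g μ ∧ AEStronglyMeasurable[⨅ n, ℱ n] g μ ∧
      Tendsto (fun n => eLpNorm (μ[f | ℱ n] - g) 1 μ) atTop (𝓝 0) := by
  have hfact : ∀ n, Fact (ℱ n ≤ mΩ) := fun n => ⟨hle n⟩
  let U : ℕ → Submodule ℝ (Lp ℝ 2 μ) := fun n => lpMeas ℝ ℝ (ℱ n) 2 μ
  have hU : Monotone fun n => (U n)ᗮ := fun m n hmn =>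
    Submodule.orthogonal_le fun x hx => by
      rw [mem_lpMeas_iff_aestronglyMeasurable] at hx ⊢
      exact hx.mono (hℱ hmn)
  have : ∀ n, (U n).HasOrthogonalProjection := fun n => by
    dsimp only [U]; infer_instance
  set F := hf.toLp f with hF
  have h1 := Submodule.starProjection_tendsto_closure_iSup (fun n => (U n)ᗮ) hU F
  set g' := (⨆ n, (U n)ᗮ).topologicalClosure.starProjection F
  set g : Lp ℝ 2 μ := F - g' with hg
  have h2 : Tendsto (fun n => (U n).starProjection F) atTop (𝓝 g) := by
    have := tendsto_const_nhds (x := F).sub h1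
    refine this.congr fun n => ?_
    rw [Submodule.starProjection_orthogonal_val, sub_sub_cancel]
  have hgm : ∀ m, AEStronglyMeasurable[ℱ m] g μ := fun m => by
    refine (isClosed_aestronglyMeasurable (F := ℝ) (p := 2) (hle m)).mem_of_tendsto h2 ?_
    filter_upwards [eventually_ge_atTop m] with n hn
    have := Submodule.starProjection_apply_mem (U n) F
    exact ((mem_lpMeas_iff_aestronglyMeasurable).1 this).mono (hℱ hn)
  refine ⟨g, (Lp.memLp g).integrable one_le_two, aestronglyMeasurable_iInf_of_antitone hℱ hgm, ?_⟩
  rw [Lp.tendsto_Lp_iff_tendsto_eLpNorm'] at h2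
  refine tendsto_of_tendsto_of_tendsto_of_le_of_le tendsto_const_nhds h2 (fun _ => zero_le)
    fun n => ?_
  have e : μ[f | ℱ n] =ᵐ[μ] ((U n).starProjection F : Lp ℝ 2 μ) :=
    (hf.condExpL2_ae_eq_condExp (𝕜 := ℝ) (hle n)).symm
  have hm := (stronglyMeasurable_condExp (f := f) (m := ℱ n) (μ := μ)).mono (hle n)
  calc eLpNorm (μ[f | ℱ n] - ⇑g) 1 μ ≤ eLpNorm (μ[f | ℱ n] - ⇑g) 2 μ :=
        eLpNorm_le_eLpNorm_of_exponent_le one_le_two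
          (hm.aestronglyMeasurable.sub (Lp.aestronglyMeasurable g))
    _ = _ := eLpNorm_congr_ae (e.sub (ae_eq_refl _))

/-- **Lévy's downward theorem** in `L¹` for square integrable functions. -/
theorem tendsto_eLpNorm_condExp_iInf_of_memLp_two [IsProbabilityMeasure μ] (hℱ : Antitone ℱ)
    (hle : ∀ n, ℱ n ≤ mΩ) {f : Ω → ℝ} (hf : MemLp f 2 μ) :
    Tendsto (fun n => eLpNorm (μ[f | ℱ n] - μ[f | ⨅ n, ℱ n]) 1 μ) atTop (𝓝 0) := by
  obtain ⟨g, hgi, hgm, hg⟩ := tendsto_condExp_of_memLp_two hℱ hle hf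
  have hle' : (⨅ n, ℱ n) ≤ mΩ := (iInf_le ℱ 0).trans (hle 0)
  have hgE : μ[g | ⨅ n, ℱ n] =ᵐ[μ] g := condExp_of_aestronglyMeasurable' hle' hgm hgi
  have hEm : AEStronglyMeasurable (μ[f | ⨅ n, ℱ n]) μ :=
    (stronglyMeasurable_condExp.mono hle').aestronglyMeasurable
  -- By the tower property the difference equals E(E(f|ℱₙ) - g | ⨅ ℱₙ) for every n, and conditioning
  -- contracts L¹.
  have key : eLpNorm (μ[f | ⨅ n, ℱ n] - g) 1 μ = 0 := by
    refine le_antisymm (ge_of_tendsto' hg fun n => ?_) zero_le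
    have e : μ[f | ⨅ n, ℱ n] - g =ᵐ[μ] μ[μ[f | ℱ n] - g | ⨅ n, ℱ n] := by
      filter_upwards [condExp_sub (integrable_condExp (f := f) (m := ℱ n)) hgi (⨅ n, ℱ n),
        condExp_condExp_of_le (f := f) (iInf_le ℱ n) (hle n), hgE] with ω h1 h2 h3
      rw [h1, Pi.sub_apply, Pi.sub_apply, h2, h3]
    rw [eLpNorm_congr_ae e]
    exact eLpNorm_condExp_le_eLpNorm _ le_rfl
  rw [eLpNorm_eq_zero_iff (hEm.sub hgi.aestronglyMeasurable) one_ne_zero] at key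
  refine hg.congr fun n => eLpNorm_congr_ae ?_
  filter_upwards [key] with ω hω
  have : μ[f | ⨅ n, ℱ n] ω - g ω = 0 := hω
  simp only [Pi.sub_apply]
  linarith

/-- Simple functions are square integrable and dense in L¹, and the L¹ contraction makes the
approximation uniform over all the σ-algebras. -/
theorem tendsto_eLpNorm_condExp_iInf [IsProbabilityMeasure μ] (hℱ : Antitone ℱ)
    (hle : ∀ n, ℱ n ≤ mΩ) {f : Ω → ℝ} (hf : Integrable f μ) :
    Tendsto (fun n => eLpNorm (μ[f | ℱ n] - μ[f | ⨅ n, ℱ n]) 1 μ) atTop (𝓝 0) := by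
  have hle' : (⨅ n, ℱ n) ≤ mΩ := (iInf_le ℱ 0).trans (hle 0)
  rw [ENNReal.tendsto_nhds_zero]
  intro ε hε
  have hε3 : ε / 3 ≠ 0 := (ENNReal.div_pos hε.ne' (by norm_num)).ne'
  obtain ⟨s, hs, -⟩ := (memLp_one_iff_integrable.2 hf).exists_simpleFunc_eLpNorm_sub_lt
    ENNReal.one_ne_top hε3
  have hs2 : MemLp s 2 μ := s.memLp_of_isFiniteMeasure 2 μ
  have hs1 : Integrable s μ := hs2.integrable one_le_two
  have hd : ∀ m : MeasurableSpace Ω, m ≤ mΩ → eLpNorm (μ[f | m] - μ[s | m]) 1 μ ≤ ε / 3 := by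
    intro m hm
    rw [← eLpNorm_congr_ae (condExp_sub hf hs1 m)]
    exact (eLpNorm_condExp_le_eLpNorm _ le_rfl).trans hs.le
  have hmeas : ∀ (m : MeasurableSpace Ω) (h : Ω → ℝ), m ≤ mΩ →
      AEStronglyMeasurable[mΩ] (μ[h | m]) μ :=
    fun m h hm => (stronglyMeasurable_condExp.mono hm).aestronglyMeasurable
  filter_upwards [ENNReal.tendsto_nhds_zero.1
    (tendsto_eLpNorm_condExp_iInf_of_memLp_two hℱ hle hs2) (ε / 3) (pos_iff_ne_zero.2 hε3)]
    with n hn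
  have e : μ[f | ℱ n] - μ[f | ⨅ n, ℱ n] = ((μ[f | ℱ n] - μ[s | ℱ n]) +
      (μ[s | ℱ n] - μ[s | ⨅ n, ℱ n])) - (μ[f | ⨅ n, ℱ n] - μ[s | ⨅ n, ℱ n]) := by abel
  rw [e]
  calc _ ≤ eLpNorm ((μ[f | ℱ n] - μ[s | ℱ n]) + (μ[s | ℱ n] - μ[s | ⨅ n, ℱ n])) 1 μ
        + eLpNorm (μ[f | ⨅ n, ℱ n] - μ[s | ⨅ n, ℱ n]) 1 μ :=
        eLpNorm_sub_le (((hmeas _ _ (hle n)).sub (hmeas _ _ (hle n))).add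
          ((hmeas _ _ (hle n)).sub (hmeas _ _ hle'))) ((hmeas _ _ hle').sub (hmeas _ _ hle')) le_rfl
    _ ≤ eLpNorm (μ[f | ℱ n] - μ[s | ℱ n]) 1 μ + eLpNorm (μ[s | ℱ n] - μ[s | ⨅ n, ℱ n]) 1 μ
        + eLpNorm (μ[f | ⨅ n, ℱ n] - μ[s | ⨅ n, ℱ n]) 1 μ := by
        gcongr
        exact eLpNorm_add_le ((hmeas _ _ (hle n)).sub (hmeas _ _ (hle n)))
          ((hmeas _ _ (hle n)).sub (hmeas _ _ hle')) le_rfl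
    _ ≤ ε / 3 + ε / 3 + ε / 3 := add_le_add (add_le_add (hd _ (hle n)) hn) (hd _ hle')
    _ = ε := ENNReal.add_thirds ε

/-- Maximal inequality for conditional expectations along a decreasing sequence of σ-algebras. -/
theorem mul_measure_exists_le_abs_condExp_le [IsProbabilityMeasure μ] (hℱ : Antitone ℱ)
    (hle : ∀ n, ℱ n ≤ mΩ) (g : Ω → ℝ) (ε : NNReal) :
    ε * μ {ω | ∃ n, (ε : ℝ) ≤ |(μ[g | ℱ n]) ω|} ≤ eLpNorm g 1 μ := by
  have hfin : ∀ k : ℕ, ε * μ {ω | ∃ n ≤ k, (ε : ℝ) ≤ |(μ[g | ℱ n]) ω|} ≤ eLpNorm g 1 μ := by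
    intro k
    -- Reversing time on {0, …, k} yields a filtration. Doob's maximal inequality is applied to the
    -- absolute value of the martingale, written as M ⊔ -M.
    let 𝒢 : Filtration ℕ mΩ := ⟨fun i => ℱ (k - i), fun i j hij => hℱ (by omega), fun i => hle _⟩
    have hM := martingale_condExp g 𝒢 μ
    have hS := hM.submartingale.sup hM.neg.submartingale
    have h := maximal_ineq hS (fun i ω => abs_nonneg ((μ[g | 𝒢 i]) ω)) (ε := ε) k
    have hset : {ω | ∃ n ≤ k, (ε : ℝ) ≤ |(μ[g | ℱ n]) ω|} ⊆
        {ω | (ε : ℝ) ≤ (Finset.range (k + 1)).sup' Finset.nonempty_range_add_one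
          fun i => ((fun i => μ[g | 𝒢 i]) ⊔ -fun i => μ[g | 𝒢 i]) i ω} := by
      rintro ω ⟨n, hn, h⟩
      have hk : k - n ∈ Finset.range (k + 1) := Finset.mem_range.2 (by omega)
      have e : k - (k - n) = n := by omega
      have h' : (ε : ℝ) ≤ |(μ[g | ℱ (k - (k - n))]) ω| := by rwa [e]
      exact h'.trans (Finset.le_sup'
        (fun i => ((fun i => μ[g | 𝒢 i]) ⊔ -fun i => μ[g | 𝒢 i]) i ω) hk)
    refine (mul_le_mul_right (measure_mono hset) _).trans (h.trans ?_)
    have hint : Integrable (((fun i => μ[g | 𝒢 i]) ⊔ -fun i => μ[g | 𝒢 i]) k) μ := hS.integrable k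
    calc _ ≤ ENNReal.ofReal (∫ ω, ((fun i => μ[g | 𝒢 i]) ⊔ -fun i => μ[g | 𝒢 i]) k ω ∂μ) := by
          refine ENNReal.ofReal_le_ofReal (setIntegral_le_integral hint (ae_of_all _ fun ω => ?_))
          exact abs_nonneg ((μ[g | 𝒢 k]) ω)
      _ = ENNReal.ofReal (∫ ω, ‖(μ[g | 𝒢 k]) ω‖ ∂μ) := rfl
      _ = eLpNorm (μ[g | 𝒢 k]) 1 μ := by
          rw [ofReal_integral_norm_eq_lintegral_enorm integrable_condExp,
            eLpNorm_one_eq_lintegral_enorm]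
      _ ≤ _ := eLpNorm_condExp_le_eLpNorm _ le_rfl
  have hU : {ω | ∃ n, (ε : ℝ) ≤ |(μ[g | ℱ n]) ω|} =
      ⋃ k : ℕ, {ω | ∃ n ≤ k, (ε : ℝ) ≤ |(μ[g | ℱ n]) ω|} := by
    ext ω
    simp only [Set.mem_ofPred_eq, Set.mem_iUnion]
    exact ⟨fun ⟨n, h⟩ => ⟨n, n, le_rfl, h⟩, fun ⟨_, n, _, h⟩ => ⟨n, h⟩⟩
  have hmono : Monotone fun k : ℕ => {ω | ∃ n ≤ k, (ε : ℝ) ≤ |(μ[g | ℱ n]) ω|} :=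
    fun k l hkl ω ⟨n, hn, h⟩ => ⟨n, hn.trans hkl, h⟩
  rw [hU, hmono.measure_iUnion, ENNReal.mul_iSup]
  exact iSup_le hfin

/-- **Lévy's downward theorem**. -/
theorem tendsto_ae_condExp_iInf [IsProbabilityMeasure μ] (hℱ : Antitone ℱ)
    (hle : ∀ n, ℱ n ≤ mΩ) {f : Ω → ℝ} (hf : Integrable f μ) :
    ∀ᵐ ω ∂μ, Tendsto (fun n => (μ[f | ℱ n]) ω) atTop (𝓝 ((μ[f | ⨅ n, ℱ n]) ω)) := by
  have hle' : (⨅ n, ℱ n) ≤ mΩ := (iInf_le ℱ 0).trans (hle 0)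
  have hL := tendsto_eLpNorm_condExp_iInf hℱ hle hf
  have key : ∀ ε : NNReal, 0 < ε → ∀ᵐ ω ∂μ, ∃ m, ∀ n,
      |(μ[f | ℱ (m + n)]) ω - (μ[f | ⨅ n, ℱ n]) ω| < ε := by
    intro ε hε
    rw [ae_iff]
    set B := {ω | ¬∃ m, ∀ n, |(μ[f | ℱ (m + n)]) ω - (μ[f | ⨅ n, ℱ n]) ω| < ε} with hB
    suffices h : (ε : ENNReal) * μ B = 0 by
      simpa [hε.ne'] using h
    -- On `B` every tail contains a deviation of at least ε. Hence for each `m` the maximal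
    -- inequality along that tail bounds ε μ(B) by the L¹ distance at time `m`, which tends to 0.
    refine le_antisymm (ge_of_tendsto' hL fun m => ?_) zero_le
    set g := μ[f | ℱ m] - μ[f | ⨅ n, ℱ n] with hg
    have hae : ∀ᵐ ω ∂μ, ∀ n, (μ[g | ℱ (m + n)]) ω =
        (μ[f | ℱ (m + n)]) ω - (μ[f | ⨅ n, ℱ n]) ω := by
      rw [ae_all_iff]
      intro n
      have h3 : μ[μ[f | ⨅ n, ℱ n] | ℱ (m + n)] = μ[f | ⨅ n, ℱ n] :=
        condExp_of_stronglyMeasurable (hle _)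
          (stronglyMeasurable_condExp.mono (iInf_le ℱ (m + n))) integrable_condExp
      filter_upwards [condExp_sub (integrable_condExp (f := f) (m := ℱ m))
        (integrable_condExp (f := f) (m := ⨅ n, ℱ n)) (ℱ (m + n)),
        condExp_condExp_of_le (f := f) (hℱ (Nat.le_add_right m n)) (hle m)] with ω h1 h2
      rw [h1, Pi.sub_apply, h2, h3]
    refine le_trans (mul_le_mul_right (measure_mono_ae ?_) _)
      (mul_measure_exists_le_abs_condExp_le (ℱ := fun n => ℱ (m + n))
        (fun i j hij => hℱ (by omega)) (fun n => hle _) g ε)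
    filter_upwards [hae] with ω hω hωB
    simp only [hB, not_exists, not_forall, not_lt] at hωB
    obtain ⟨n, hn⟩ := hωB m
    exact ⟨n, by rw [hω n]; exact hn⟩
  have key' : ∀ᵐ ω ∂μ, ∀ j : ℕ, ∃ m, ∀ n,
      |(μ[f | ℱ (m + n)]) ω - (μ[f | ⨅ n, ℱ n]) ω| < 1 / ((j : ℝ) + 1) := by
    rw [ae_all_iff]
    intro j
    have := key (1 / ((j : NNReal) + 1)) (by positivity)
    simpa using this
  filter_upwards [key'] with ω hω
  rw [Metric.tendsto_atTop]
  intro ε hε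
  obtain ⟨j, hj⟩ := exists_nat_one_div_lt hε
  obtain ⟨m, hm⟩ := hω j
  refine ⟨m, fun n hn => ?_⟩
  obtain ⟨k, rfl⟩ := Nat.exists_eq_add_of_le hn
  exact (hm k).trans hj

end Downward

end MeasureTheory

namespace CCSpace

/-! ### Conditional expectations of simple random elements. -/

section SimpleCondExp

variable {Ω E : Type*} {G G' : MeasurableSpace Ω} {mΩ : MeasurableSpace Ω} {μ : Measure Ω}
  [IsProbabilityMeasure μ]

theorem condExp_sum_mul_indicator {ι : Type*} (t : Finset ι)
    {A : ι → Set Ω} (hA : ∀ i, MeasurableSet (A i)) (c : ι → ℝ) :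
    μ[fun ω => ∑ i ∈ t, c i * (A i).indicator (fun _ => (1 : ℝ)) ω | G] =ᵐ[μ]
      fun ω => ∑ i ∈ t, c i * (μ[(A i).indicator (fun _ => (1 : ℝ)) | G]) ω := by
  have hint : ∀ i, Integrable ((A i).indicator (fun _ => (1 : ℝ))) μ := fun i =>
    (integrable_const 1).indicator (hA i)
  have h1 := condExp_finsetSum (μ := μ) (s := t)
    (f := fun i => c i • (A i).indicator (fun _ => (1 : ℝ))) (fun i _ => (hint i).smul (c i)) G
  have h2 : ∀ᵐ ω ∂μ, ∀ i ∈ t, (μ[c i • (A i).indicator (fun _ => (1 : ℝ)) | G]) ω =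
      c i * (μ[(A i).indicator (fun _ => (1 : ℝ)) | G]) ω := by
    rw [Filter.eventually_all_finset]
    intro i _
    filter_upwards [condExp_smul (μ := μ) (c i) ((A i).indicator (fun _ => (1 : ℝ))) G] with ω hω
    rw [hω, Pi.smul_apply, smul_eq_mul]
  have e : (fun ω => ∑ i ∈ t, c i * (A i).indicator (fun _ => (1 : ℝ)) ω) =
      ∑ i ∈ t, c i • (A i).indicator (fun _ => (1 : ℝ)) := by
    ext ω
    simp
  rw [e]
  filter_upwards [h1, h2] with ω hω1 hω2
  rw [hω1, Finset.sum_apply]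
  exact Finset.sum_congr rfl hω2

/-- The conditional probability of `S = x` given `G`. -/
noncomputable abbrev condWeight (G : MeasurableSpace Ω) {mΩ : MeasurableSpace Ω} (μ : Measure Ω)
    (S : SimpleFunc Ω E) (x : E)    (ω : Ω) : ℝ :=
  (μ[(S ⁻¹' {x}).indicator (fun _ => (1 : ℝ)) | G]) ω

theorem ae_condWeight (hG : G ≤ mΩ) (S : SimpleFunc Ω E) :
    ∀ᵐ ω ∂μ, (∀ x ∈ S.range, 0 ≤ condWeight G μ S x ω) ∧
      ∑ x ∈ S.range, condWeight G μ S x ω = 1 := by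
  classical
  have h1 : ∀ᵐ ω ∂μ, ∀ x ∈ S.range, 0 ≤ condWeight G μ S x ω := by
    rw [Filter.eventually_all_finset]
    intro x _
    exact condExp_nonneg (ae_of_all _ fun ω => Set.indicator_nonneg (fun _ _ => zero_le_one) ω)
  have h2 := condExp_sum_mul_indicator (G := G) (μ := μ) S.range (A := fun x => S ⁻¹' {x})
    (fun x => S.measurableSet_fiber x) (fun _ => 1)
  have e : (fun ω => ∑ x ∈ S.range, 1 * (S ⁻¹' {x}).indicator (fun _ => (1 : ℝ)) ω) =
      fun _ => 1 := by
    ext ω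
    simp [Set.indicator_apply]
  rw [e, condExp_const hG] at h2
  filter_upwards [h1, h2] with ω hω1 hω2
  exact ⟨hω1, by simpa using hω2.symm⟩

/-- The coupling is the conditional probability of {S = x, T = y} given `G`; its marginals and its
cost follow from linearity of real conditional expectation. -/
theorem ae_condWeight_coupling (S T : SimpleFunc Ω E) (c : E → E → ℝ) :
    ∃ γ : E → E → Ω → ℝ, ∀ᵐ ω ∂μ, (∀ x ∈ S.range, ∀ y ∈ T.range, 0 ≤ γ x y ω) ∧
      (∀ x ∈ S.range, condWeight G μ S x ω = ∑ y ∈ T.range, γ x y ω) ∧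
      (∀ y ∈ T.range, condWeight G μ T y ω = ∑ x ∈ S.range, γ x y ω) ∧
      ∑ x ∈ S.range, ∑ y ∈ T.range, γ x y ω * c x y = (μ[fun ω => c (S ω) (T ω) | G]) ω := by
  classical
  have hm : ∀ x y, MeasurableSet (S ⁻¹' {x} ∩ T ⁻¹' {y}) := fun x y =>
    (S.measurableSet_fiber x).inter (T.measurableSet_fiber y)
  refine ⟨fun x y => μ[(S ⁻¹' {x} ∩ T ⁻¹' {y}).indicator (fun _ => (1 : ℝ)) | G], ?_⟩
  have h1 : ∀ᵐ ω ∂μ, ∀ x ∈ S.range, ∀ y ∈ T.range,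
      0 ≤ (μ[(S ⁻¹' {x} ∩ T ⁻¹' {y}).indicator (fun _ => (1 : ℝ)) | G]) ω := by
    rw [Filter.eventually_all_finset]
    intro x _
    rw [Filter.eventually_all_finset]
    intro y _
    exact condExp_nonneg (ae_of_all _ fun ω => Set.indicator_nonneg (fun _ _ => zero_le_one) ω)
  have h2 : ∀ᵐ ω ∂μ, ∀ x ∈ S.range, condWeight G μ S x ω = ∑ y ∈ T.range,
      (μ[(S ⁻¹' {x} ∩ T ⁻¹' {y}).indicator (fun _ => (1 : ℝ)) | G]) ω := by
    rw [Filter.eventually_all_finset]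
    intro x _
    have h := condExp_sum_mul_indicator (G := G) (μ := μ) T.range
      (A := fun y => S ⁻¹' {x} ∩ T ⁻¹' {y})
      (fun y => hm x y) (fun _ => 1)
    have e : (fun ω => ∑ y ∈ T.range,
        1 * (S ⁻¹' {x} ∩ T ⁻¹' {y}).indicator (fun _ => (1 : ℝ)) ω) =
        (S ⁻¹' {x}).indicator (fun _ => (1 : ℝ)) := by
      ext ω
      by_cases hx : S ω = x <;> simp [Set.indicator_apply, hx]
    rw [e] at h
    filter_upwards [h] with ω hω
    simpa using hω
  have h3 : ∀ᵐ ω ∂μ, ∀ y ∈ T.range, condWeight G μ T y ω = ∑ x ∈ S.range,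
      (μ[(S ⁻¹' {x} ∩ T ⁻¹' {y}).indicator (fun _ => (1 : ℝ)) | G]) ω := by
    rw [Filter.eventually_all_finset]
    intro y _
    have h := condExp_sum_mul_indicator (G := G) (μ := μ) S.range
      (A := fun x => S ⁻¹' {x} ∩ T ⁻¹' {y})
      (fun x => hm x y) (fun _ => 1)
    have e : (fun ω => ∑ x ∈ S.range,
        1 * (S ⁻¹' {x} ∩ T ⁻¹' {y}).indicator (fun _ => (1 : ℝ)) ω) =
        (T ⁻¹' {y}).indicator (fun _ => (1 : ℝ)) := by
      ext ω
      by_cases hy : T ω = y <;> simp [Set.indicator_apply, hy]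
    rw [e] at h
    filter_upwards [h] with ω hω
    simpa using hω
  have h4 := condExp_sum_mul_indicator (G := G) (μ := μ) (S.range ×ˢ T.range)
    (A := fun q => S ⁻¹' {q.1} ∩ T ⁻¹' {q.2}) (fun q => hm q.1 q.2) (fun q => c q.1 q.2)
  have e : (fun ω => ∑ q ∈ S.range ×ˢ T.range,
      c q.1 q.2 * (S ⁻¹' {q.1} ∩ T ⁻¹' {q.2}).indicator (fun _ => (1 : ℝ)) ω) =
      fun ω => c (S ω) (T ω) := by
    ext ω
    rw [Finset.sum_eq_single (S ω, T ω)]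
    · simp
    · intro q _ hq
      have : ¬(S ω = q.1 ∧ T ω = q.2) := fun h => hq (Prod.ext h.1.symm h.2.symm)
      simp [this]
    · simp
  rw [e] at h4
  filter_upwards [h1, h2, h3, h4] with ω hω1 hω2 hω3 hω4
  refine ⟨hω1, hω2, hω3, ?_⟩
  rw [hω4, Finset.sum_product]
  exact Finset.sum_congr rfl fun x _ => Finset.sum_congr rfl fun y _ => mul_comm _ _

variable [MetricSpace E]

theorem integrable_dist_simpleFunc (S T : SimpleFunc Ω E) :
    Integrable (fun ω => dist (S ω) (T ω)) μ :=
  ((S.pair T).map fun q : E × E => dist q.1 q.2).integrable_of_isFiniteMeasure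

variable [CCSpace E]

theorem integrable_dist_convexify_simpleFunc (S T : SimpleFunc Ω E) :
    Integrable (fun ω => dist (convexify (S ω)) (convexify (T ω))) μ :=
  SimpleFunc.integrable_of_isFiniteMeasure
    ((S.pair T).map fun q : E × E => dist (convexify q.1) (convexify q.2))

/-- Conditional expectation is nonexpansive on simple random elements. -/
theorem dist_simpleCondExp_le (hG : G ≤ mΩ) (S T : SimpleFunc Ω E) :
    ∀ᵐ ω ∂μ, dist (simpleCondExp G μ S ω) (simpleCondExp G μ T ω) ≤
      (μ[fun ω => dist (S ω) (T ω) | G]) ω := by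
  obtain ⟨γ, hγ⟩ := ae_condWeight_coupling (G := G) (μ := μ) S T
    (fun x y => dist (convexify x) (convexify y))
  have hmono : μ[fun ω => dist (convexify (S ω)) (convexify (T ω)) | G] ≤ᵐ[μ]
      μ[fun ω => dist (S ω) (T ω) | G] :=
    condExp_mono (integrable_dist_convexify_simpleFunc S T) (integrable_dist_simpleFunc S T)
      (ae_of_all _ fun ω => dist_convexify_le _ _)
  filter_upwards [hγ, hmono, ae_condWeight hG S] with ω ⟨h1, h2, h3, h4⟩ h5 h6
  refine le_trans ?_ h5
  rw [← h4]
  exact dist_combOn_le_of_coupling (fun x => isConvexPt_convexify x)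
    (fun x => isConvexPt_convexify x) h1 h6.2 h2 h3

theorem simpleCondExp_const (hG : G ≤ mΩ) (b : E) :
    ∀ᵐ ω ∂μ, simpleCondExp G μ (SimpleFunc.const Ω b) ω = convexify b := by
  filter_upwards [ae_condWeight (μ := μ) hG (SimpleFunc.const Ω b)] with ω hω
  have : Nonempty Ω := ⟨ω⟩
  rw [SimpleFunc.range_const] at hω
  have h1 : condWeight G μ (SimpleFunc.const Ω b) b ω = 1 := by simpa using hω.2
  have hw : IsWeight fun _ : Fin 1 => condWeight G μ (SimpleFunc.const Ω b) b ω :=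
    ⟨fun _ => by rw [h1]; exact one_pos, by simpa using h1⟩
  unfold simpleCondExp
  rw [SimpleFunc.range_const, combOn_eq_comb (fun _ : Fin 1 => b)
    (fun _ _ _ => Subsingleton.elim _ _) (fun _ => by simp)
    (fun k hk _ => ⟨0, (Finset.mem_singleton.1 hk).symm⟩)
    hw, comb_fin_one hw]

/-- The sum of the mutual distances of the convexified values of `S`. -/
noncomputable def spread (S : SimpleFunc Ω E) : ℝ :=
  ∑ x ∈ S.range, ∑ y ∈ S.range, dist (convexify x) (convexify y)

theorem dist_convexify_le_spread (S : SimpleFunc Ω E) {x y : E} (hx : x ∈ S.range)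
    (hy : y ∈ S.range) : dist (convexify x) (convexify y) ≤ spread S :=
  (Finset.single_le_sum (f := fun y => dist (convexify x) (convexify y))
    (fun _ _ => dist_nonneg) hy).trans
    (Finset.single_le_sum (f := fun x => ∑ y ∈ S.range, dist (convexify x) (convexify y))
      (fun _ _ => Finset.sum_nonneg fun _ _ => dist_nonneg) hx)

theorem spread_nonneg (S : SimpleFunc Ω E) : 0 ≤ spread S :=
  Finset.sum_nonneg fun _ _ => Finset.sum_nonneg fun _ _ => dist_nonneg

theorem dist_simpleCondExp_le_weights (hG : G ≤ mΩ) (hG' : G' ≤ mΩ)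
    (S : SimpleFunc Ω E) :
    ∀ᵐ ω ∂μ, dist (simpleCondExp G μ S ω) (simpleCondExp G' μ S ω) ≤
      spread S * ∑ x ∈ S.range, |condWeight G μ S x ω - condWeight G' μ S x ω| := by
  filter_upwards [ae_condWeight hG S, ae_condWeight hG' S] with ω h h'
  exact dist_combOn_weights_le (fun x => isConvexPt_convexify x) h.1 h'.1 h.2 h'.2
    fun x hx y hy => dist_convexify_le_spread S hx hy

/-- Two probability vectors have ℓ¹ distance at most 2. This constant is the dominating function for
L^p convergence. -/
theorem dist_simpleCondExp_le_const (hG : G ≤ mΩ) (hG' : G' ≤ mΩ)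
    (S : SimpleFunc Ω E) :
    ∀ᵐ ω ∂μ, dist (simpleCondExp G μ S ω) (simpleCondExp G' μ S ω) ≤ spread S * 2 := by
  filter_upwards [ae_condWeight hG S, ae_condWeight hG' S,
    dist_simpleCondExp_le_weights hG hG' S] with ω h h' hd
  refine hd.trans (mul_le_mul_of_nonneg_left ?_ (spread_nonneg S))
  calc _ ≤ ∑ x ∈ S.range, (condWeight G μ S x ω + condWeight G' μ S x ω) :=
        Finset.sum_le_sum fun x hx => by
          have := h.1 x hx
          have := h'.1 x hx
          exact abs_le.2 ⟨by linarith, by linarith⟩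
    _ = 2 := by rw [Finset.sum_add_distrib, h.2, h'.2]; norm_num

/-- The combination is a continuous function of the weights on the closed simplex, also at faces
where terms are dropped, by the Lipschitz bound. Chosen versions of the conditional probabilities
lie in the simplex only a.s.; elsewhere an arbitrary value is used. -/
theorem exists_measurable_simpleCondExp [MeasurableSpace E] [BorelSpace E]
    (hG : G ≤ mΩ) (S : SimpleFunc Ω E) :
    ∃ f : Ω → E, Measurable[G] f ∧ simpleCondExp G μ S =ᵐ[μ] f := by
  classical
  obtain ⟨ω₀⟩ : Nonempty Ω := μ.nonempty_of_neZero
  let ext : (S.range → ℝ) → E → ℝ := fun w x => if h : x ∈ S.range then w ⟨x, h⟩ else 0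
  let Δ : Set (S.range → ℝ) := {w | (∀ i, 0 ≤ w i) ∧ ∑ i, w i = 1}
  let Φ : (S.range → ℝ) → E := fun w => combOn S.range (ext w) convexify
  have hext : ∀ w (i : S.range), ext w i = w i := fun w i => dif_pos i.2
  have hsum : ∀ w, ∑ x ∈ S.range, ext w x = ∑ i, w i := fun w => by
    rw [← Finset.sum_coe_sort]
    simp only [hext]
  have hext0 : ∀ w ∈ Δ, ∀ x ∈ S.range, 0 ≤ ext w x := fun w hw x hx => by
    rw [hext w ⟨x, hx⟩]; exact hw.1 _
  have hΔ : IsClosed Δ := by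
    have e : Δ = (⋂ i, {w | 0 ≤ w i}) ∩ {w | ∑ i, w i = 1} := by ext w; simp [Δ]
    rw [e]
    exact (isClosed_iInter fun i => isClosed_le continuous_const (continuous_apply i)).inter
      (isClosed_eq (by fun_prop) continuous_const)
  have hΦ : ContinuousOn Φ Δ := by
    intro w hw
    rw [ContinuousWithinAt, tendsto_iff_dist_tendsto_zero]
    have hlim : Tendsto (fun v : S.range → ℝ => spread S * ∑ i, |v i - w i|) (𝓝[Δ] w) (𝓝 0) := by
      have : Continuous fun v : S.range → ℝ => spread S * ∑ i, |v i - w i| := by fun_prop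
      simpa using (this.tendsto w).mono_left nhdsWithin_le_nhds
    refine squeeze_zero' (Eventually.of_forall fun _ => dist_nonneg) ?_ hlim
    filter_upwards [self_mem_nhdsWithin] with v hv
    have := dist_combOn_weights_le (s := S.range) (fun x : E => isConvexPt_convexify x)
      (hext0 v hv) (hext0 w hw) (by rw [hsum]; exact hv.2) (by rw [hsum]; exact hw.2)
      (fun x hx y hy => dist_convexify_le_spread S hx hy)
    rw [← Finset.sum_coe_sort] at this
    simpa only [hext] using this
  have hmeas : Measurable (Δ.piecewise Φ (fun _ => S ω₀)) :=
    hΦ.measurable_piecewise continuousOn_const hΔ.measurableSet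
  have hW : Measurable[G] fun ω => fun i : S.range => condWeight G μ S i ω :=
    @measurable_pi_lambda _ _ _ G _ _ fun i => stronglyMeasurable_condExp.measurable
  refine ⟨fun ω => Δ.piecewise Φ (fun _ => S ω₀) fun i : S.range => condWeight G μ S i ω,
    hmeas.comp hW, ?_⟩
  filter_upwards [ae_condWeight hG S] with ω hω
  have hmem : (fun i : S.range => condWeight G μ S i ω) ∈ Δ :=
    ⟨fun i => hω.1 i i.2, by
      rw [Finset.sum_coe_sort S.range (fun x => condWeight G μ S x ω)]; exact hω.2⟩
  rw [Set.piecewise_eq_of_mem _ _ _ hmem]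
  exact combOn_congr hω.1 hω.2 (fun x hx => (hext (fun i => condWeight G μ S i ω) ⟨x, hx⟩).symm) _

end SimpleCondExp

end CCSpace

namespace CCSpace

/-! ### Existence of E(X|G), the approximation error, and integrability. -/

section CondExp

theorem exists_measurable_lim {Ω E : Type*} [MeasurableSpace Ω] [MetricSpace E] [CompleteSpace E]
    [SecondCountableTopology E] [MeasurableSpace E] [BorelSpace E] (a : E) {f : ℕ → Ω → E}
    (hf : ∀ n, Measurable (f n)) :
    ∃ Y : Ω → E, Measurable Y ∧
      ∀ ω, (∃ c, Tendsto (f · ω) atTop (𝓝 c)) → Tendsto (f · ω) atTop (𝓝 (Y ω)) := by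
  classical
  have hC : MeasurableSet {ω | ∃ c, Tendsto (f · ω) atTop (𝓝 c)} :=
    measurableSet_exists_tendsto hf
  let Y : Ω → E := fun ω => if h : ∃ c, Tendsto (f · ω) atTop (𝓝 c) then h.choose else a
  have hY : ∀ ω, (∃ c, Tendsto (f · ω) atTop (𝓝 c)) → Tendsto (f · ω) atTop (𝓝 (Y ω)) :=
    fun ω h => by
      simp only [Y, dif_pos h]
      exact h.choose_spec
  refine ⟨Y, measurable_of_tendsto_metrizable
    (f := fun n => Set.piecewise {ω | ∃ c, Tendsto (f · ω) atTop (𝓝 c)} (f n) fun _ => a)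
    (fun n => (hf n).piecewise hC measurable_const) (tendsto_pi_nhds.2 fun ω => ?_), hY⟩
  by_cases h : ∃ c, Tendsto (f · ω) atTop (𝓝 c)
  · simpa [h] using hY ω h
  · simp [h, Y]

variable {Ω E : Type*} {G : MeasurableSpace Ω} {mΩ : MeasurableSpace Ω} {μ : Measure Ω}
  [MetricSpace E] [MeasurableSpace E] [BorelSpace E]

theorem dist_nearestPt_antitone (u : ℕ → E) (x : E) :
    Antitone fun n => dist (SimpleFunc.nearestPt u n x) x := by
  intro m n hmn
  have h := SimpleFunc.edist_nearestPt_le u x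
    ((SimpleFunc.nearestPtInd_le u m x).trans hmn)
  rw [edist_dist, edist_dist] at h
  exact (ENNReal.ofReal_le_ofReal_iff dist_nonneg).1 h

theorem tendsto_dist_nearestPt {u : ℕ → E} (hu : DenseRange u) (x : E) :
    Tendsto (fun n => dist (SimpleFunc.nearestPt u n x) x) atTop (𝓝 0) :=
  tendsto_iff_dist_tendsto_zero.1 (SimpleFunc.tendsto_nearestPt (hu x))

/-- The distance of `X` from its approximation by the nearest of the points `u 0, …, u n`. -/
noncomputable def approxError (u : ℕ → E) (X : Ω → E) (n : ℕ) (ω : Ω) : ℝ :=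
  dist (SimpleFunc.nearestPt u n (X ω)) (X ω)

variable {u : ℕ → E} {X : Ω → E}

theorem approxError_le_zero (n : ℕ) (ω : Ω) : approxError u X n ω ≤ approxError u X 0 ω :=
  dist_nearestPt_antitone u (X ω) (Nat.zero_le n)

theorem approxError_nonneg (n : ℕ) (ω : Ω) : 0 ≤ approxError u X n ω := dist_nonneg

theorem tendsto_approxError (hu : DenseRange u) (ω : Ω) :
    Tendsto (fun n => approxError u X n ω) atTop (𝓝 0) :=
  tendsto_dist_nearestPt hu (X ω)

variable [SecondCountableTopology E]

theorem measurable_approxError (hX : Measurable X) (n : ℕ) : Measurable (approxError u X n) :=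
  ((SimpleFunc.measurable _).comp hX).dist hX

theorem integrable_approxError (hX : Measurable X) (hi : Integrable (fun ω => dist (u 0) (X ω)) μ)
    (n : ℕ) : Integrable (approxError u X n) μ :=
  hi.mono' (measurable_approxError hX n).aestronglyMeasurable (ae_of_all _ fun ω => by
    rw [Real.norm_of_nonneg (approxError_nonneg n ω)]
    exact approxError_le_zero n ω)

variable [IsProbabilityMeasure μ]

/-- The conditional errors are nonnegative and a.s. decreasing in `n`, and their integrals tend to 0
by dominated convergence. -/
theorem tendsto_condExp_approxError (hG : G ≤ mΩ) (hu : DenseRange u) (hX : Measurable X)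
    (hi : Integrable (fun ω => dist (u 0) (X ω)) μ) :
    ∀ᵐ ω ∂μ, Tendsto (fun n => (μ[approxError u X n | G]) ω) atTop (𝓝 0) := by
  have hint := integrable_approxError (u := u) hX hi
  refine tendsto_of_integral_tendsto_of_antitone (F := fun _ => 0) (fun n => integrable_condExp)
    (integrable_zero _ _ _) ?_ ?_ ?_
  · simp_rw [integral_condExp hG]
    exact tendsto_integral_of_dominated_convergence (fun ω => dist (u 0) (X ω))
      (fun n => (hint n).aestronglyMeasurable) hi (fun n => ae_of_all _ fun ω => by
        rw [Real.norm_of_nonneg (approxError_nonneg n ω)]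
        exact approxError_le_zero n ω) (ae_of_all _ fun ω => tendsto_approxError hu ω)
  · have : ∀ᵐ ω ∂μ, ∀ n, (μ[approxError u X (n + 1) | G]) ω ≤ (μ[approxError u X n | G]) ω :=
      ae_all_iff.2 fun n => condExp_mono (hint _) (hint _)
        (ae_of_all _ fun ω => dist_nearestPt_antitone u (X ω) n.le_succ)
    filter_upwards [this] with ω hω using antitone_nat_of_succ_le hω
  · exact ae_all_iff.2 fun n => condExp_nonneg (ae_of_all _ fun ω => approxError_nonneg n ω)

variable [CCSpace E]

theorem dist_simpleCondExp_nearestPt_le (hG : G ≤ mΩ) (hX : Measurable X)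
    (hi : Integrable (fun ω => dist (u 0) (X ω)) μ) (m n : ℕ) :
    ∀ᵐ ω ∂μ, dist (simpleCondExp G μ ((SimpleFunc.nearestPt u m).comp X hX) ω)
        (simpleCondExp G μ ((SimpleFunc.nearestPt u n).comp X hX) ω) ≤
      (μ[approxError u X m | G]) ω + (μ[approxError u X n | G]) ω := by
  have hint := integrable_approxError (u := u) hX hi
  filter_upwards [dist_simpleCondExp_le (μ := μ) hG ((SimpleFunc.nearestPt u m).comp X hX)
    ((SimpleFunc.nearestPt u n).comp X hX),
    condExp_mono (m := G) (integrable_dist_simpleFunc (μ := μ)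
      ((SimpleFunc.nearestPt u m).comp X hX) ((SimpleFunc.nearestPt u n).comp X hX))
      ((hint m).add (hint n)) (ae_of_all _ fun ω => dist_triangle_right _ _ (X ω)),
    condExp_add (hint m) (hint n) G] with ω h1 h2 h3
  refine h1.trans (h2.trans_eq ?_)
  rw [h3, Pi.add_apply]

theorem exists_isCondExp [CompleteSpace E] (hG : G ≤ mΩ) (hu : DenseRange u) (hX : Measurable X)
    (hi : Integrable (fun ω => dist (u 0) (X ω)) μ) : ∃ Y, IsCondExp u G μ X hX Y := by
  classical
  choose f hf hSf using fun n => exists_measurable_simpleCondExp (μ := μ) hG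
    ((SimpleFunc.nearestPt u n).comp X hX)
  obtain ⟨Y, hYm, hY⟩ := @exists_measurable_lim _ _ G _ _ _ _ _ (u 0) f hf
  refine ⟨Y, hYm, ?_⟩
  have hC : ∀ᵐ ω ∂μ, ∃ c, Tendsto (f · ω) atTop (𝓝 c) := by
    filter_upwards [ae_all_iff.2 hSf, tendsto_condExp_approxError hG hu hX hi,
      ae_all_iff.2 fun m => ae_all_iff.2 fun n => dist_simpleCondExp_nearestPt_le (u := u) (μ := μ)
        hG hX hi m n] with ω h1 h2 h3
    refine cauchySeq_tendsto_of_complete ?_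
    rw [Metric.cauchySeq_iff]
    intro ε hε
    obtain ⟨N, hN⟩ := eventually_atTop.1 (h2.eventually_lt_const (half_pos hε))
    refine ⟨N, fun m hm n hn => ?_⟩
    rw [← h1, ← h1]
    have := h3 m n
    have := hN m hm
    have := hN n hn
    linarith
  filter_upwards [hC, ae_all_iff.2 hSf] with ω h1 h2
  exact (hY ω h1).congr fun n => (h2 n).symm

/-- In the estimate comparing two approximations, let one index tend to infinity; its error term
vanishes. -/
theorem IsCondExp.dist_le {hX : Measurable X} {Y : Ω → E} (hY : IsCondExp u G μ X hX Y)
    (hG : G ≤ mΩ) (hu : DenseRange u) (hi : Integrable (fun ω => dist (u 0) (X ω)) μ) :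
    ∀ᵐ ω ∂μ, ∀ n, dist (simpleCondExp G μ ((SimpleFunc.nearestPt u n).comp X hX) ω) (Y ω) ≤
      (μ[approxError u X n | G]) ω := by
  filter_upwards [hY.2, tendsto_condExp_approxError hG hu hX hi,
      ae_all_iff.2 fun m => ae_all_iff.2 fun n => dist_simpleCondExp_nearestPt_le (u := u) (μ := μ)
        hG hX hi m n] with ω h1 h2 h3 n
  refine le_of_tendsto_of_tendsto' (tendsto_const_nhds.dist h1) ?_ (h3 n)
  simpa using h2.const_add ((μ[approxError u X n | G]) ω)

/-- This is the error bound at index 0: ψ₀(X) is constantly `u 0`, whose conditional expectation is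
`K (u 0)`. -/
theorem IsCondExp.dist_convexify_le {hX : Measurable X} {Y : Ω → E}
    (hY : IsCondExp u G μ X hX Y) (hG : G ≤ mΩ) (hu : DenseRange u)
    (hi : Integrable (fun ω => dist (u 0) (X ω)) μ) :
    ∀ᵐ ω ∂μ, dist (convexify (u 0)) (Y ω) ≤ (μ[fun ω => dist (u 0) (X ω) | G]) ω := by
  filter_upwards [hY.dist_le hG hu hi, simpleCondExp_const (μ := μ) hG (u 0)] with ω h1 h2
  have := h1 0
  have e : (SimpleFunc.nearestPt u 0).comp X hX = SimpleFunc.const Ω (u 0) := rfl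
  rw [e, h2] at this
  exact this

/-- With base point `K (u 0)`, the distance is dominated by a real conditional expectation, which
stays in L^p. -/
theorem IsCondExp.memLpE {hX : Measurable X} {Y : Ω → E} (hY : IsCondExp u G μ X hX Y)
    (hG : G ≤ mΩ) (hu : DenseRange u) {p : ℝ} (hp : 1 ≤ p)
    (hi : MemLp (fun ω => dist (u 0) (X ω)) (ENNReal.ofReal p) μ) : MemLpE p G μ Y := by
  have hp1 : 1 ≤ ENNReal.ofReal p := by simpa using ENNReal.ofReal_le_ofReal hp
  refine ⟨hY.1, convexify (u 0), ?_⟩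
  have hm : MemLp (fun ω => dist (convexify (u 0)) (Y ω)) (ENNReal.ofReal p) μ := by
    refine (hi.condExp (m := G) hp1).mono'
      (measurable_const.dist (hY.1.mono hG le_rfl)).aestronglyMeasurable ?_
    filter_upwards [hY.dist_convexify_le hG hu (hi.integrable hp1)] with ω hω
    rwa [Real.norm_of_nonneg dist_nonneg]
  have := hm.integrable_norm_rpow (by simp; linarith) ENNReal.ofReal_ne_top
  simpa [ENNReal.toReal_ofReal (zero_le_one.trans hp)] using this

end CondExp

/-! ### Convergence along a sequence of σ-algebras, given the real theorem. -/

section Convergence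

variable {Ω : Type*} {𝒢 : ℕ → MeasurableSpace Ω} {𝒢' : MeasurableSpace Ω}
  {mΩ : MeasurableSpace Ω} {μ : Measure Ω}

theorem tendsto_eLpNorm_zero_of_dominated {p : ℝ} (hp : 1 ≤ p) {F : ℕ → Ω → ℝ} {g : Ω → ℝ}
    (hF : ∀ n, AEStronglyMeasurable (F n) μ) (hg : MemLp g (ENNReal.ofReal p) μ)
    (hFg : ∀ n, ∀ᵐ ω ∂μ, ‖F n ω‖ ≤ g ω) (hlim : ∀ᵐ ω ∂μ, Tendsto (fun n => F n ω) atTop (𝓝 0)) :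
    Tendsto (fun n => eLpNorm (F n) (ENNReal.ofReal p) μ) atTop (𝓝 0) := by
  have hp0 : 0 < p := zero_lt_one.trans_le hp
  have hpne : ENNReal.ofReal p ≠ 0 := by simpa using hp0
  have hpr : (ENNReal.ofReal p).toReal = p := ENNReal.toReal_ofReal hp0.le
  simp_rw [eLpNorm_eq_lintegral_rpow_enorm_toReal hpne ENNReal.ofReal_ne_top, hpr]
  have h : Tendsto (fun n => ∫⁻ ω, ‖F n ω‖ₑ ^ p ∂μ) atTop (𝓝 (∫⁻ _, 0 ∂μ)) := by
    refine tendsto_lintegral_of_dominated_convergence' (fun ω => ‖g ω‖ₑ ^ p)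
      (fun n => (hF n).enorm.pow_const p) (fun n => ?_) ?_ ?_
    · filter_upwards [hFg n] with ω hω
      gcongr
      exact enorm_le_iff_norm_le.2 (hω.trans (le_abs_self _))
    · have := lintegral_rpow_enorm_lt_top_of_eLpNorm_lt_top hpne ENNReal.ofReal_ne_top hg.2
      rw [hpr] at this
      exact this.ne
    · filter_upwards [hlim] with ω hω
      have := (ENNReal.continuous_rpow_const (y := p)).tendsto 0 |>.comp (by
        simpa using hω.enorm)
      simpa [hp0, Function.comp_def] using this
  rw [lintegral_zero] at h
  have := (ENNReal.continuous_rpow_const (y := 1 / p)).tendsto 0 |>.comp h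
  simpa [hp0, Function.comp_def] using this

theorem lpDist_eq_eLpNorm {E : Type*} [MetricSpace E] {p : ℝ} (hp : 1 ≤ p) (Y Z : Ω → E) :
    lpDist p μ Y Z = eLpNorm (fun ω => dist (Y ω) (Z ω)) (ENNReal.ofReal p) μ := by
  have hp0 : 0 < p := zero_lt_one.trans_le hp
  rw [eLpNorm_eq_lintegral_rpow_enorm_toReal (by simpa using hp0) ENNReal.ofReal_ne_top,
    ENNReal.toReal_ofReal hp0.le, lpDist]
  simp_rw [edist_dist, Real.enorm_of_nonneg dist_nonneg]

variable [IsProbabilityMeasure μ]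

theorem tendsto_simpleCondExp {E : Type*} [MetricSpace E] [CCSpace E]
    (h𝒢 : ∀ n, 𝒢 n ≤ mΩ) (h𝒢' : 𝒢' ≤ mΩ)
    (hlevy : ∀ f : Ω → ℝ, Integrable f μ →
      ∀ᵐ ω ∂μ, Tendsto (fun n => (μ[f | 𝒢 n]) ω) atTop (𝓝 ((μ[f | 𝒢']) ω)))
    (S : SimpleFunc Ω E) :
    ∀ᵐ ω ∂μ, Tendsto (fun n => dist (simpleCondExp (𝒢 n) μ S ω) (simpleCondExp 𝒢' μ S ω))
      atTop (𝓝 0) := by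
  have hw : ∀ᵐ ω ∂μ, ∀ x ∈ S.range, Tendsto (fun n => condWeight (𝒢 n) μ S x ω) atTop
      (𝓝 (condWeight 𝒢' μ S x ω)) := by
    rw [Filter.eventually_all_finset]
    exact fun x _ => hlevy _ ((integrable_const 1).indicator (S.measurableSet_fiber x))
  filter_upwards [hw, ae_all_iff.2 fun n => dist_simpleCondExp_le_weights (μ := μ) (h𝒢 n) h𝒢' S]
    with ω h1 h2
  refine squeeze_zero (fun _ => dist_nonneg) h2 ?_
  have : Tendsto (fun n => ∑ x ∈ S.range, |condWeight (𝒢 n) μ S x ω - condWeight 𝒢' μ S x ω|)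
      atTop (𝓝 (∑ x ∈ S.range, 0)) := tendsto_finsetSum _ fun x hx => by
    simpa using ((h1 x hx).sub_const (condWeight 𝒢' μ S x ω)).abs
  simpa using this.const_mul (spread S)

variable {E : Type*} [MetricSpace E] [SecondCountableTopology E] [MeasurableSpace E]
  [BorelSpace E] [CCSpace E] {u : ℕ → E} {X : Ω → E}

/-- If real conditional expectations given `𝒢 n` converge to those given `𝒢'`, then so do the
conditional expectations of an integrable random element. -/
theorem IsCondExp.tendsto_ae {hX : Measurable X} {Y : ℕ → Ω → E} {Z : Ω → E}
    (hY : ∀ n, IsCondExp u (𝒢 n) μ X hX (Y n)) (hZ : IsCondExp u 𝒢' μ X hX Z)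
    (h𝒢 : ∀ n, 𝒢 n ≤ mΩ) (h𝒢' : 𝒢' ≤ mΩ)
    (hlevy : ∀ f : Ω → ℝ, Integrable f μ →
      ∀ᵐ ω ∂μ, Tendsto (fun n => (μ[f | 𝒢 n]) ω) atTop (𝓝 ((μ[f | 𝒢']) ω)))
    (hu : DenseRange u) (hi : Integrable (fun ω => dist (u 0) (X ω)) μ) :
    ∀ᵐ ω ∂μ, Tendsto (fun n => Y n ω) atTop (𝓝 (Z ω)) := by
  filter_upwards [ae_all_iff.2 fun n => (hY n).dist_le (h𝒢 n) hu hi, hZ.dist_le h𝒢' hu hi,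
    ae_all_iff.2 fun m => hlevy _ (integrable_approxError (u := u) hX hi m),
    ae_all_iff.2 fun m => tendsto_simpleCondExp (μ := μ) h𝒢 h𝒢' hlevy
      ((SimpleFunc.nearestPt u m).comp X hX),
    tendsto_condExp_approxError h𝒢' hu hX hi] with ω h1 h2 h3 h4 h5
  rw [tendsto_iff_dist_tendsto_zero, Metric.tendsto_atTop]
  intro ε hε
  -- Choose `m` from the limit σ-algebra alone. Real convergence carries the strict bound over to `𝒢
  -- n` for large `n`, so the three terms sum to less than 3ε/4.
  obtain ⟨m, hm⟩ := (h5.eventually_lt_const (show 0 < ε / 4 by positivity)).exists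
  obtain ⟨N, hN⟩ := eventually_atTop.1 (((h3 m).eventually_lt_const hm).and
    ((h4 m).eventually_lt_const (show 0 < ε / 4 by positivity)))
  refine ⟨N, fun n hn => ?_⟩
  obtain ⟨hn1, hn2⟩ := hN n hn
  rw [Real.dist_0_eq_abs, abs_of_nonneg dist_nonneg]
  have e1 := h1 n m
  have e2 := h2 m
  have e3 := dist_triangle4_left
    (simpleCondExp (𝒢 n) μ ((SimpleFunc.nearestPt u m).comp X hX) ω)
    (simpleCondExp 𝒢' μ ((SimpleFunc.nearestPt u m).comp X hX) ω) (Y n ω) (Z ω)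
  linarith

/-- The same three-term split: contraction in L^p bounds both outer errors uniformly in `n`, and
dominated convergence handles the middle term for fixed `m`. -/
theorem IsCondExp.tendsto_lpDist {hX : Measurable X} {Y : ℕ → Ω → E} {Z : Ω → E}
    (hY : ∀ n, IsCondExp u (𝒢 n) μ X hX (Y n)) (hZ : IsCondExp u 𝒢' μ X hX Z)
    (h𝒢 : ∀ n, 𝒢 n ≤ mΩ) (h𝒢' : 𝒢' ≤ mΩ)
    (hlevy : ∀ f : Ω → ℝ, Integrable f μ →
      ∀ᵐ ω ∂μ, Tendsto (fun n => (μ[f | 𝒢 n]) ω) atTop (𝓝 ((μ[f | 𝒢']) ω)))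
    (hu : DenseRange u) {p : ℝ} (hp : 1 ≤ p)
    (hi : MemLp (fun ω => dist (u 0) (X ω)) (ENNReal.ofReal p) μ) :
    Tendsto (fun n => lpDist p μ (Y n) Z) atTop (𝓝 0) := by
  have hp1 : 1 ≤ ENNReal.ofReal p := by simpa using ENNReal.ofReal_le_ofReal hp
  have hi1 := hi.integrable hp1
  have herr : Tendsto (fun m => eLpNorm (approxError u X m) (ENNReal.ofReal p) μ) atTop (𝓝 0) :=
    tendsto_eLpNorm_zero_of_dominated hp
      (fun m => (measurable_approxError hX m).aestronglyMeasurable) hi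
      (fun m => ae_of_all _ fun ω => by
        rw [Real.norm_of_nonneg (approxError_nonneg m ω)]
        exact approxError_le_zero m ω) (ae_of_all _ fun ω => tendsto_approxError hu ω)
  set D : ℕ → ℕ → Ω → ℝ := fun m n ω =>
    dist (simpleCondExp (𝒢 n) μ ((SimpleFunc.nearestPt u m).comp X hX) ω)
      (simpleCondExp 𝒢' μ ((SimpleFunc.nearestPt u m).comp X hX) ω) with hD
  -- Measurability of `simpleCondExp` is available only up to null sets, so measurable versions are
  -- substituted.
  have hDm : ∀ m n, AEStronglyMeasurable (D m n) μ := fun m n => by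
    obtain ⟨f, hf, hf'⟩ := exists_measurable_simpleCondExp (μ := μ) (h𝒢 n)
      ((SimpleFunc.nearestPt u m).comp X hX)
    obtain ⟨g, hg, hg'⟩ := exists_measurable_simpleCondExp (μ := μ) h𝒢'
      ((SimpleFunc.nearestPt u m).comp X hX)
    refine ⟨fun ω => dist (f ω) (g ω),
      ((hf.mono (h𝒢 n) le_rfl).dist (hg.mono h𝒢' le_rfl)).stronglyMeasurable, ?_⟩
    filter_upwards [hf', hg'] with ω h1 h2
    simp only [hD, h1, h2]
  have hDlim : ∀ m, Tendsto (fun n => eLpNorm (D m n) (ENNReal.ofReal p) μ) atTop (𝓝 0) :=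
    fun m => tendsto_eLpNorm_zero_of_dominated hp (hDm m)
      (memLp_const (spread ((SimpleFunc.nearestPt u m).comp X hX) * 2))
      (fun n => by
        filter_upwards [dist_simpleCondExp_le_const (μ := μ) (h𝒢 n) h𝒢'
          ((SimpleFunc.nearestPt u m).comp X hX)] with ω hω
        rwa [Real.norm_of_nonneg dist_nonneg])
      (tendsto_simpleCondExp h𝒢 h𝒢' hlevy _)
  have hbound : ∀ m n, lpDist p μ (Y n) Z ≤ eLpNorm (approxError u X m) (ENNReal.ofReal p) μ +
      eLpNorm (D m n) (ENNReal.ofReal p) μ + eLpNorm (approxError u X m) (ENNReal.ofReal p) μ := by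
    intro m n
    rw [lpDist_eq_eLpNorm hp]
    have hm1 : AEStronglyMeasurable (μ[approxError u X m | 𝒢 n]) μ :=
      (stronglyMeasurable_condExp.mono (h𝒢 n)).aestronglyMeasurable
    have hm2 : AEStronglyMeasurable (μ[approxError u X m | 𝒢']) μ :=
      (stronglyMeasurable_condExp.mono h𝒢').aestronglyMeasurable
    calc _ ≤ eLpNorm (μ[approxError u X m | 𝒢 n] + D m n + μ[approxError u X m | 𝒢'])
          (ENNReal.ofReal p) μ := by
          refine eLpNorm_mono_ae_real ?_
          filter_upwards [(hY n).dist_le (h𝒢 n) hu hi1, hZ.dist_le h𝒢' hu hi1] with ω h1 h2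
          rw [Real.norm_of_nonneg dist_nonneg]
          have e1 := h1 m
          have e2 := h2 m
          have e3 := dist_triangle4_left
            (simpleCondExp (𝒢 n) μ ((SimpleFunc.nearestPt u m).comp X hX) ω)
            (simpleCondExp 𝒢' μ ((SimpleFunc.nearestPt u m).comp X hX) ω) (Y n ω) (Z ω)
          simp only [Pi.add_apply, hD]
          linarith
      _ ≤ eLpNorm (μ[approxError u X m | 𝒢 n]) (ENNReal.ofReal p) μ +
          eLpNorm (D m n) (ENNReal.ofReal p) μ +
          eLpNorm (μ[approxError u X m | 𝒢']) (ENNReal.ofReal p) μ :=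
          (eLpNorm_add_le (hm1.add (hDm m n)) hm2 hp1).trans
            (add_le_add_left (eLpNorm_add_le hm1 (hDm m n) hp1) _)
      _ ≤ _ := add_le_add (add_le_add (eLpNorm_condExp_le_eLpNorm _ hp1) le_rfl)
          (eLpNorm_condExp_le_eLpNorm _ hp1)
  rw [ENNReal.tendsto_nhds_zero]
  intro ε hε
  have hε3 : 0 < ε / 3 := ENNReal.div_pos hε.ne' (by norm_num)
  obtain ⟨m, hm⟩ := (ENNReal.tendsto_nhds_zero.1 herr _ hε3).exists
  filter_upwards [ENNReal.tendsto_nhds_zero.1 (hDlim m) _ hε3] with n hn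
  exact (hbound m n).trans ((add_le_add (add_le_add hm hn) hm).trans_eq (ENNReal.add_thirds ε))

theorem MemLpE.memLp_dist {E : Type*} [MetricSpace E] [SecondCountableTopology E]
    [MeasurableSpace E] [BorelSpace E] {X : Ω → E} {p : ℝ} (hp : 1 ≤ p) (hX : MemLpE p mΩ μ X)
    (b : E) : MemLp (fun ω => dist b (X ω)) (ENNReal.ofReal p) μ := by
  have hp0 : 0 < p := zero_lt_one.trans_le hp
  obtain ⟨a, ha⟩ := hX.2
  have hm : ∀ c : E, AEStronglyMeasurable (fun ω => dist c (X ω)) μ := fun c =>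
    (measurable_const.dist hX.1).aestronglyMeasurable
  have h1 : MemLp (fun ω => dist a (X ω)) (ENNReal.ofReal p) μ := by
    rw [← integrable_norm_rpow_iff (hm a) (by simpa using hp0) ENNReal.ofReal_ne_top,
      ENNReal.toReal_ofReal hp0.le]
    simpa using ha
  refine ((memLp_const (dist b a)).add h1).mono' (hm b) (ae_of_all _ fun ω => ?_)
  rw [Real.norm_of_nonneg dist_nonneg]
  exact dist_triangle b a (X ω)

end Convergence

end CCSpace

theorem proposition4p13 {Ω E : Type*} {mΩ : MeasurableSpace Ω} (μ : Measure Ω)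
    [IsProbabilityMeasure μ]
    [MetricSpace E] [CompleteSpace E] [TopologicalSpace.SeparableSpace E]
    [MeasurableSpace E] [BorelSpace E] [CCSpace E]
    (u : ℕ → E) (hu₀ : u 0 ∈ Set.range (CCSpace.convexify (E := E)))
    (hu : DenseRange fun j : ℕ => u (j + 1))
    (p : ℝ) (hp : 1 ≤ p) (X : Ω → E) (hX : CCSpace.MemLpE p mΩ μ X) :
    -- conditional expectations of `X` exist
    (∀ G : MeasurableSpace Ω, G ≤ mΩ → ∃ Y : Ω → E, CCSpace.IsCondExp u G μ X hX.1 Y) ∧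
    -- (i) increasing sequences
    (∀ ℱ : ℕ → MeasurableSpace Ω, Monotone ℱ → (∀ n, ℱ n ≤ mΩ) →
      ∀ (Y : ℕ → Ω → E) (Z : Ω → E),
        (∀ n, CCSpace.IsCondExp u (ℱ n) μ X hX.1 (Y n)) →
        CCSpace.IsCondExp u (⨆ n, ℱ n) μ X hX.1 Z →
        (∀ᵐ ω ∂μ, Tendsto (fun n => Y n ω) atTop (𝓝 (Z ω))) ∧
        (∀ n, CCSpace.MemLpE p (ℱ n) μ (Y n)) ∧
        CCSpace.MemLpE p (⨆ n, ℱ n) μ Z ∧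
        Tendsto (fun n => CCSpace.lpDist p μ (Y n) Z) atTop (𝓝 0)) ∧
    -- (ii) decreasing sequences
    (∀ ℱ : ℕ → MeasurableSpace Ω, Antitone ℱ → (∀ n, ℱ n ≤ mΩ) →
      ∀ (Y : ℕ → Ω → E) (Z : Ω → E),
        (∀ n, CCSpace.IsCondExp u (ℱ n) μ X hX.1 (Y n)) →
        CCSpace.IsCondExp u (⨅ n, ℱ n) μ X hX.1 Z →
        (∀ᵐ ω ∂μ, Tendsto (fun n => Y n ω) atTop (𝓝 (Z ω))) ∧
        (∀ n, CCSpace.MemLpE p (ℱ n) μ (Y n)) ∧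
        CCSpace.MemLpE p (⨅ n, ℱ n) μ Z ∧
        Tendsto (fun n => CCSpace.lpDist p μ (Y n) Z) atTop (𝓝 0)) := by
  have : SecondCountableTopology E := UniformSpace.secondCountable_of_separable E
  have hu' : DenseRange u := hu.mono (Set.range_comp_subset_range (fun j : ℕ => j + 1) u)
  have hLp := hX.memLp_dist hp (u 0)
  have hi := hLp.integrable (by simpa using ENNReal.ofReal_le_ofReal hp)
  -- Both directions are instances of one statement whose only input on the σ-algebras is a.s.
  -- convergence of real conditional expectations.
  have main : ∀ (𝒢 : ℕ → MeasurableSpace Ω) (𝒢' : MeasurableSpace Ω), (∀ n, 𝒢 n ≤ mΩ) →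
      𝒢' ≤ mΩ → (∀ f : Ω → ℝ, Integrable[mΩ] f μ → ∀ᵐ ω ∂μ,
        Tendsto (fun n => (μ[f | 𝒢 n]) ω) atTop (𝓝 ((μ[f | 𝒢']) ω))) →
      ∀ (Y : ℕ → Ω → E) (Z : Ω → E),
        (∀ n, CCSpace.IsCondExp u (𝒢 n) μ X hX.1 (Y n)) →
        CCSpace.IsCondExp u 𝒢' μ X hX.1 Z →
        (∀ᵐ ω ∂μ, Tendsto (fun n => Y n ω) atTop (𝓝 (Z ω))) ∧
        (∀ n, CCSpace.MemLpE p (𝒢 n) μ (Y n)) ∧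
        CCSpace.MemLpE p 𝒢' μ Z ∧
        Tendsto (fun n => CCSpace.lpDist p μ (Y n) Z) atTop (𝓝 0) :=
    fun 𝒢 𝒢' h𝒢 h𝒢' hlevy Y Z hY hZ =>
      ⟨CCSpace.IsCondExp.tendsto_ae hY hZ h𝒢 h𝒢' hlevy hu' hi,
        fun n => (hY n).memLpE (h𝒢 n) hu' hp hLp, hZ.memLpE h𝒢' hu' hp hLp,
        CCSpace.IsCondExp.tendsto_lpDist hY hZ h𝒢 h𝒢' hlevy hu' hp hLp⟩
  refine ⟨fun G hG => CCSpace.exists_isCondExp hG hu' hX.1 hi, fun ℱ hℱ hle => ?_,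
    fun ℱ hℱ hle => ?_⟩
  · exact main ℱ _ hle (iSup_le hle) fun f _ => tendsto_ae_condExp (ℱ := ⟨ℱ, hℱ, hle⟩) f
  · exact main ℱ _ hle ((iInf_le ℱ 0).trans (hle 0)) fun f hf => tendsto_ae_condExp_iInf hℱ hle hf
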